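/- Let $p\ge 3$ be a prime, and let $\Gamma(n)\subset SL(2,\mathbb Z)$ denote the principal congruence subgroup of level $n$. Put $$\Gamma_\pm(4p)=\{\beta\in\Gamma(4)\;:\;\beta\equiv\pm 1 \pmod p\},\qquad X_\pm(4p)=\Gamma_\pm(4p)\backslash\mathbb H^*,\qquad \mathbb H^*=\mathbb H\cup\mathbb P^1(\mathbb Q).$$ With $q=e^{2\pi i z}$ let $\theta(z)=\sum_{n\in\mathbb Z}q^{n^2}$, $\varphi(z)=\theta(z)-\theta((z+2)/4)$, and let $M=\theta^2$, $N=2\theta\varphi$, $P=\varphi^2$ (modular forms of weight $1$ on $\Gamma(4)$). For a real matrix $\alpha=\begin{pmatrix}a&b\\c&d\end{pmatrix}$ of positive determinant write $(f|\alpha)(z)=f(\alpha z)(cz+d)^{-1}$, and let $$S=\Big\{\begin{pmatrix}1&0\\0&1\end{pmatrix}\Big\}\cup\Big\{\begin{pmatrix}1&t\\0&p\end{pmatrix}: 0\le t<p\Big\}.$$ Let $F$ be the map from $X_\pm(4p)$ to projective space over $\mathbb C$ with the $3(p+1)$ homogeneous coordinates $f|\alpha$, $f\in\{M,N,P\}$,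 $\alpha\in S$: the class of $z\in\mathbb H$ goes to the point with coordinates $(f|\alpha)(z)$, and the class of a cusp $\gamma\infty$, $\gamma\in SL(2,\mathbb Z)$, goes to the point whose coordinates are the constant terms (the limits as $\operatorname{Im} z\to\infty$) of the forms $f|\alpha\gamma$. **Theorem 3.5.** The map $F$ is well defined. Represent cusps $a/c\in\mathbb P^1(\mathbb Q)$ by vectors $(a,c)\in\mathbb Z^2$ with $\gcd(a,c)=1$ (where $a/c=\infty$ if $c=0$). Two cusps $(a,c)$ and $(a',c')$ have the same image under $F$ if and only if there is a unit $\mu\in(\mathbb Z/4p\mathbb Z)^*$ with $$(a',c')\equiv\mu\,(a,c)\pmod{4p}.$$ The curve $X_\pm(4p)$ has exactly $3(p^2-1)$ cusps, and their images under $F$ are exactly $6(p+1)$ distinct points. -/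

import Mathlib

open scoped MatrixGroups UpperHalfPlane ModularForm LinearAlgebra.Projectivization

namespace CuspIdent

noncomputable section

/-! ### The weight one forms `M`, `N`, `P` on `Γ(4)` -/

/-- `θ(z) = ∑_{n ∈ ℤ} q ^ (n ^ 2)` with `q = exp (2πiz)`. -/
def theta (z : ℂ) : ℂ :=
  ∑' n : ℤ, Complex.exp (2 * Real.pi * Complex.I * (n : ℂ) ^ 2 * z)

/-- `φ(z) = θ(z) - θ((z + 2) / 4)`. -/
def phi (z : ℂ) : ℂ := theta z - theta ((z + 2) / 4)

/-- The three forms `M = θ²`, `N = 2θφ`, `P = φ²`, in this order. -/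
def baseForm : Fin 3 → ℍ → ℂ :=
  ![fun z => theta z ^ 2, fun z => 2 * theta z * phi z, fun z => phi z ^ 2]

/-! ### The modular curve `X_±(4p)` -/

/-- `SL(2, ℤ)` acts on `ℙ¹(ℚ) = ℚ ∪ {∞}` by Möbius transformations. -/
instance instActionP1Q : MulAction SL(2, ℤ) (OnePoint ℚ) :=
  MulAction.compHom (OnePoint ℚ) (Matrix.SpecialLinearGroup.mapGL ℚ : SL(2, ℤ) →* GL (Fin 2) ℚ)

/-- The extended upper half plane `ℍ* = ℍ ∪ ℙ¹(ℚ)`, on which `SL(2, ℤ)` acts componentwise by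
Möbius transformations. -/
abbrev ExtendedUHP : Type := ℍ ⊕ OnePoint ℚ

/-- Reduction `SL(2, ℤ) → SL(2, ℤ/n)`. -/
def reduce (n : ℕ) : SL(2, ℤ) →* Matrix.SpecialLinearGroup (Fin 2) (ZMod n) :=
  Matrix.SpecialLinearGroup.map (Int.castRingHom (ZMod n))

/-- `Γ_±(4p)`: the elements of `Γ(4)` that are congruent to `±1` modulo `p`. -/
def gammaPM (p : ℕ) : Subgroup SL(2, ℤ) where
  carrier := {β | β ∈ CongruenceSubgroup.Gamma 4 ∧ (reduce p β = 1 ∨ reduce p β = -1)}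
  one_mem' := ⟨one_mem _, Or.inl (map_one _)⟩
  mul_mem' := by
    rintro a b ⟨ha, ha'⟩ ⟨hb, hb'⟩
    refine ⟨mul_mem ha hb, ?_⟩
    rcases ha' with h | h <;> rcases hb' with h' | h' <;> simp [h, h']
  inv_mem' := by
    rintro a ⟨ha, ha'⟩
    refine ⟨inv_mem ha, ?_⟩
    rcases ha' with h | h
    · left; rw [map_inv, h, inv_one]
    · right; rw [map_inv, h]; exact inv_eq_of_mul_eq_one_right (by simp)

/-- The set of points of `X_±(4p) = Γ_±(4p) \ ℍ*`. -/
abbrev XPM (p : ℕ) : Type := MulAction.orbitRel.Quotient (gammaPM p) ExtendedUHP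

/-- The point of `X_±(4p)` represented by a point of `ℍ*`. -/
def toXPM (p : ℕ) (x : ExtendedUHP) : XPM p := Quotient.mk _ x

/-- The element `a / c` of `ℙ¹(ℚ)` (which is `∞` if `c = 0`). -/
def ratCusp (a c : ℤ) : OnePoint ℚ :=
  if c = 0 then OnePoint.infty else (((a : ℚ) / (c : ℚ) : ℚ) : OnePoint ℚ)

/-- The point of `X_±(4p)` represented by the cusp `a / c`. -/
def cuspPt (p : ℕ) (a c : ℤ) : XPM p := toXPM p (Sum.inr (ratCusp a c))

/-- The set of cusps of `X_±(4p)`. -/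
def cuspSet (p : ℕ) : Set (XPM p) := Set.range fun x : OnePoint ℚ => toXPM p (Sum.inr x)

/-! ### The morphism `F` -/

/-- The set `S` of matrices: `none` stands for the identity and `some t` for `(1 t; 0 p)`,
`0 ≤ t < p`. -/
def sMatrix (p : ℕ) [Fact p.Prime] : Option (Fin p) → GL (Fin 2) ℝ
  | none => 1
  | some t => Matrix.GeneralLinearGroup.mkOfDetNeZero !![1, ((t : ℕ) : ℝ); 0, (p : ℝ)]
      (by simp [Matrix.det_fin_two, (Fact.out : p.Prime).ne_zero])

/-- The index set of the homogeneous coordinates: a form in `{M, N, P}` and a matrix in `S`. -/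
abbrev Coord (p : ℕ) : Type := Fin 3 × Option (Fin p)

/-- The forms `f|α` for `f ∈ {M, N, P}` and `α ∈ S`, where `(f|α)(z) = f(αz) j(α, z)⁻¹`
(in weight one the slash action has no determinant factor). -/
def coordForm (p : ℕ) [Fact p.Prime] (i : Coord p) : ℍ → ℂ :=
  baseForm i.1 ∣[(1 : ℤ)] sMatrix p i.2

/-- `F : X_±(4p) → ℙ^N` is the map with homogeneous coordinates `f|α`, for `f ∈ {M, N, P}` and
`α ∈ S`: a point `z ∈ ℍ` goes to the point with coordinates `(f|α)(z)`, and a cusp `γ∞`, with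
`γ ∈ SL(2, ℤ)`, goes to the point whose coordinates are the constant terms at `i∞` of the forms
`f|αγ`. -/
def IsTheMap (p : ℕ) [Fact p.Prime] (F : XPM p → ℙ ℂ (Coord p → ℂ)) : Prop :=
  (∀ z : ℍ, ∃ h : (fun i => coordForm p i z) ≠ 0,
    F (toXPM p (Sum.inl z)) = Projectivization.mk ℂ (fun i => coordForm p i z) h) ∧
  (∀ γ : SL(2, ℤ), ∃ (v : Coord p → ℂ) (hv : v ≠ 0),
    (∀ i, Filter.Tendsto (coordForm p i ∣[(1 : ℤ)] γ) UpperHalfPlane.atImInfty (nhds (v i))) ∧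
    F (toXPM p (Sum.inr (γ • (OnePoint.infty : OnePoint ℚ)))) = Projectivization.mk ℂ v hv)

end

end CuspIdent

namespace CuspIdent

open Complex Filter Topology ModularGroup

/-! The functions M + P, M - P and N are permuted by `S` and `T` up to powers of i. This comes from
the inversion formula for the Jacobi theta function and from splitting ∑ q^(n²/4) by the parity of
n. Hence SL(2, ℤ) acts on them by monomial matrices that depend only on residues modulo 4
(`isMonomial`), and the constant term at a/c is 0 or a power of i read off from (a, c) mod 4.

For α = (1 t; 0 p), write αγ = δg with δ in SL(2, ℤ) and g upper triangular. The lower right entry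
of g is 1 if p ∣ a + tc and p otherwise, so a nonzero constant term has absolute value 1 or 1/p
accordingly (`tendsto_thetaSq_sMatrix`). The block α = 1 determines (a, c) mod 4 up to sign and
forces any factor of proportionality to be a power of i. Absolute values in the other blocks then
reveal which t satisfy p ∣ a + tc, that is, the point (a : c) of the projective line over 𝔽_p.
Nothing more about (a, c) mod p enters the coordinates, whence `mk_cuspVec_eq_iff`; the Chinese
remainder theorem merges the two moduli.

On the curve itself, cusps coincide exactly when their vectors agree up to independent signs modulo
4 and modulo p (`toXPM_smul_infty_eq_iff`). This is finer than the relation above, so F is well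
defined at cusps. On ℍ it is well defined because αβα⁻¹ lies in Γ(4) for the relevant β and the
coordinates have no common zero. Finally, coprime vectors realise all 12(p² - 1) pairs of residues;
dividing by free actions of groups of order 4 and 2(p - 1) gives the two counts. -/

/-! ### Transformation formulas for θ and φ. -/

lemma theta_eq_jacobiTheta (z : ℂ) : theta z = jacobiTheta (2 * z) := by
  unfold theta jacobiTheta
  exact tsum_congr fun n => by ring_nf

lemma summable_jacobiTheta {τ : ℂ} (hτ : 0 < τ.im) :
    Summable fun n : ℤ => cexp (Real.pi * I * (n : ℂ) ^ 2 * τ) := by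
  have := (summable_jacobiTheta₂_term_iff 0 τ).2 hτ
  simpa [jacobiTheta₂_term] using this

lemma exp_pi_mul_sq (n : ℤ) : cexp (Real.pi * I * (n : ℂ) ^ 2) = (-1) ^ n.natAbs := by
  have h : (Real.pi * I * (n : ℂ) ^ 2) = ((n.natAbs ^ 2 : ℕ) : ℂ) * (Real.pi * I) := by
    have : ((n.natAbs ^ 2 : ℕ) : ℂ) = ((n ^ 2 : ℤ) : ℂ) := by
      rw [← show ((n.natAbs ^ 2 : ℕ) : ℤ) = n ^ 2 by simp, Int.cast_natCast]
    rw [this]; push_cast; ring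
  rw [h, Complex.exp_nat_mul, Complex.exp_pi_mul_I, pow_two, pow_mul]
  rcases Nat.even_or_odd n.natAbs with h | h <;> simp [h.neg_one_pow]

lemma exp_half_pi_mul_sq (n : ℤ) :
    cexp (Real.pi * I * (n : ℂ) ^ 2 * (1 / 2)) = (1 + I) / 2 + (1 - I) / 2 * (-1) ^ n.natAbs := by
  rcases Int.even_or_odd' n with ⟨k, rfl | rfl⟩
  · have h : (Real.pi * I * ((2 * k : ℤ) : ℂ) ^ 2 * (1 / 2)) =
        ((k ^ 2 : ℤ) : ℂ) * (2 * Real.pi * I) := by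
      push_cast; ring
    rw [h, Complex.exp_int_mul_two_pi_mul_I, (Int.natAbs_even.2 (even_two_mul k)).neg_one_pow]
    ring
  · have h : (Real.pi * I * ((2 * k + 1 : ℤ) : ℂ) ^ 2 * (1 / 2)) =
        ((k ^ 2 + k : ℤ) : ℂ) * (2 * Real.pi * I) + Real.pi / 2 * I := by
      push_cast; ring
    rw [h, Complex.exp_add, Complex.exp_int_mul_two_pi_mul_I, Complex.exp_pi_div_two_mul_I,
      (Int.natAbs_odd.2 (odd_two_mul_add_one k)).neg_one_pow]
    ring

lemma jacobiTheta_add_jacobiTheta_add_one {τ : ℂ} (hτ : 0 < τ.im) :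
    jacobiTheta τ + jacobiTheta (τ + 1) = 2 * jacobiTheta (4 * τ) := by
  have h1 : 0 < (τ + 1).im := by simpa using hτ
  have hinj : Function.Injective fun n : ℤ => 2 * n := fun a b h => by simpa using h
  unfold jacobiTheta
  rw [← (summable_jacobiTheta hτ).tsum_add (summable_jacobiTheta h1), ← tsum_mul_left,
    ← hinj.tsum_eq]
  · refine tsum_congr fun n => ?_
    rw [mul_add (Real.pi * I * _), mul_one, Complex.exp_add, exp_pi_mul_sq,
      (Int.natAbs_even.2 (even_two_mul n)).neg_one_pow, mul_one, ← two_mul]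
    push_cast
    ring_nf
  · intro n hn
    rcases Int.even_or_odd' n with ⟨k, rfl | rfl⟩
    · exact ⟨k, rfl⟩
    · refine absurd ?_ hn
      change cexp _ + cexp _ = 0
      rw [mul_add (Real.pi * I * _), mul_one, Complex.exp_add, exp_pi_mul_sq,
        (Int.natAbs_odd.2 (odd_two_mul_add_one k)).neg_one_pow]
      ring

/-- The factor exp(πin²/2) is 1 for even n and i for odd n, hence an affine function of the sign
(-1)^n produced by the shift by 1. -/
lemma jacobiTheta_add_half {τ : ℂ} (hτ : 0 < τ.im) :
    jacobiTheta (τ + 1 / 2) =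
      (1 + I) / 2 * jacobiTheta τ + (1 - I) / 2 * jacobiTheta (τ + 1) := by
  have h1 : 0 < (τ + 1).im := by simpa using hτ
  unfold jacobiTheta
  rw [← tsum_mul_left, ← tsum_mul_left, ← ((summable_jacobiTheta hτ).mul_left _).tsum_add
    ((summable_jacobiTheta h1).mul_left _)]
  refine tsum_congr fun n => ?_
  rw [mul_add (Real.pi * I * _), mul_add (Real.pi * I * _), mul_one, Complex.exp_add,
    Complex.exp_add, exp_pi_mul_sq, exp_half_pi_mul_sq]
  ring

lemma jacobiTheta_neg_inv {τ : ℂ} (hτ : 0 < τ.im) :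
    jacobiTheta (-1 / τ) = (-I * τ) ^ (1 / 2 : ℂ) * jacobiTheta τ := by
  have := jacobiTheta_S_smul ⟨τ, hτ⟩
  rw [UpperHalfPlane.modular_S_smul] at this
  rw [← this]
  congr 1
  simp [neg_div, one_div, inv_neg]

/-- Parity splitting of ∑ q^(n²/4): θ collects the even n and φ the odd n. -/
lemma theta_add_phi {z : ℂ} (hz : 0 < z.im) : theta z + phi z = jacobiTheta (z / 2) := by
  have h : 0 < (z / 2).im := by simpa using hz
  have := jacobiTheta_add_jacobiTheta_add_one h
  rw [phi, theta_eq_jacobiTheta, theta_eq_jacobiTheta,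
    show 2 * ((z + 2) / 4) = z / 2 + 1 by ring]
  rw [show 4 * (z / 2) = 2 * z by ring] at this
  linear_combination -this

lemma theta_sub_phi (z : ℂ) : theta z - phi z = jacobiTheta (z / 2 + 1) := by
  rw [phi, theta_eq_jacobiTheta ((z + 2) / 4), show 2 * ((z + 2) / 4) = z / 2 + 1 by ring]
  ring

lemma theta_add_one (z : ℂ) : theta (z + 1) = theta z := by
  rw [theta_eq_jacobiTheta, theta_eq_jacobiTheta, ← jacobiTheta_two_add (2 * z)]
  ring_nf

lemma phi_add_one {z : ℂ} (hz : 0 < z.im) : phi (z + 1) = I * phi z := by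
  have h1 : 0 < (z + 1).im := by simpa using hz
  have h : 0 < (z / 2).im := by simpa using hz
  have e := theta_add_phi h1
  rw [theta_add_one, show (z + 1) / 2 = z / 2 + 1 / 2 by ring, jacobiTheta_add_half h,
    ← theta_add_phi hz, ← theta_sub_phi] at e
  linear_combination e

lemma theta_neg_inv {z : ℂ} (hz : 0 < z.im) :
    theta (-1 / z) = (-I * (z / 2)) ^ (1 / 2 : ℂ) * (theta z + phi z) := by
  have h : 0 < (z / 2).im := by simpa using hz
  have hz0 : z ≠ 0 := by rintro rfl; simp at hz
  rw [theta_add_phi hz, ← jacobiTheta_neg_inv h, theta_eq_jacobiTheta]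
  congr 1
  field_simp

lemma im_neg_inv_pos {z : ℂ} (hz : 0 < z.im) : 0 < (-1 / z).im := by
  have := (ModularGroup.S • (⟨z, hz⟩ : ℍ)).im_pos
  rw [UpperHalfPlane.modular_S_smul] at this
  simpa [neg_div, one_div, inv_neg, ← UpperHalfPlane.coe_im] using this

lemma four_mul_cpow_half {w : ℂ} (hw : w ≠ 0) :
    (4 * w) ^ (1 / 2 : ℂ) = 2 * w ^ (1 / 2 : ℂ) := by
  have h4 : Complex.log (4 * w) = 2 * Complex.log 2 + Complex.log w := by
    have h := Complex.log_ofReal_mul (r := 4) (by norm_num) hw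
    have h2 : Real.log 4 = 2 * Real.log 2 := by
      rw [show (4 : ℝ) = 2 ^ 2 by norm_num, Real.log_pow]; norm_num
    rw [h2] at h
    push_cast at h
    rw [h, Complex.ofReal_log (by norm_num)]
    norm_num
  rw [Complex.cpow_def_of_ne_zero (by simpa using hw), Complex.cpow_def_of_ne_zero hw, h4,
    add_mul, Complex.exp_add, show 2 * Complex.log 2 * (1 / 2) = Complex.log 2 by ring,
    Complex.exp_log two_ne_zero]

lemma phi_neg_inv {z : ℂ} (hz : 0 < z.im) :
    phi (-1 / z) = (-I * (z / 2)) ^ (1 / 2 : ℂ) * (theta z - phi z) := by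
  have h2 : 0 < (2 * z).im := by simpa using hz
  have hz0 : z ≠ 0 := by rintro rfl; simp at hz
  have e := theta_add_phi (im_neg_inv_pos hz)
  rw [theta_neg_inv hz, show -1 / z / 2 = -1 / (2 * z) by field_simp, jacobiTheta_neg_inv h2,
    ← theta_eq_jacobiTheta, show -I * (2 * z) = 4 * (-I * (z / 2)) by ring,
    four_mul_cpow_half (by simpa using hz0)] at e
  linear_combination e

lemma sq_cpow_half (w : ℂ) : (w ^ (1 / 2 : ℂ)) ^ 2 = w := by
  rw [← Complex.cpow_nat_mul]; simp

lemma tendsto_jacobiTheta_comap : Tendsto jacobiTheta (comap im atTop) (𝓝 1) := by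
  have h : Tendsto (fun τ : ℂ => Real.exp (-Real.pi * τ.im)) (comap im atTop) (𝓝 0) := by
    refine Real.tendsto_exp_atBot.comp ?_
    exact tendsto_comap.const_mul_atTop_of_neg (by linarith [Real.pi_pos])
  have := isBigO_at_im_infty_jacobiTheta_sub_one.trans_tendsto h
  simpa using this.add_const 1

lemma jacobiTheta_ne_zero_of_one_le_im {τ : ℂ} (hτ : 1 ≤ τ.im) : jacobiTheta τ ≠ 0 := by
  intro h0
  have h := norm_jacobiTheta_sub_one_le (τ := τ) (by linarith)
  rw [h0, zero_sub, norm_neg, norm_one] at h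
  -- With x = exp(-π Im τ), the bound 2x/(1 - x) on the distance to 1 is below 1 exactly when x <
  -- 1/3.
  have h1 : Real.exp (-Real.pi * τ.im) < 1 / 3 := by
    have h3 : Real.exp (-Real.pi * τ.im) ≤ Real.exp (-2) := by
      apply Real.exp_le_exp.2
      nlinarith [Real.pi_gt_three]
    have h5 : (3 : ℝ) < Real.exp 2 := by linarith [Real.add_one_lt_exp (two_ne_zero (α := ℝ))]
    have h6 : Real.exp (-2) < 1 / 3 := by
      rw [Real.exp_neg, ← one_div]
      exact one_div_lt_one_div_of_lt (by norm_num) h5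
    linarith
  have h2 : 0 < 1 - Real.exp (-Real.pi * τ.im) := by linarith
  rw [div_mul_eq_mul_div, le_div_iff₀ h2] at h
  linarith

/-! ### The monomial action of SL(2, ℤ). -/

/-- The functions `M + P`, `M - P`, `N`, which `SL(2, ℤ)` permutes up to powers of `i`. -/
noncomputable def thetaSq : Fin 3 → ℍ → ℂ :=
  ![fun z => theta z ^ 2 + phi z ^ 2, fun z => theta z ^ 2 - phi z ^ 2,
    fun z => 2 * theta z * phi z]

/-- The power `i ^ k` for an exponent modulo `4`. -/
noncomputable def iPow (k : ZMod 4) : ℂ := I ^ k.val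

lemma iPow_add (a b : ZMod 4) : iPow (a + b) = iPow a * iPow b := by
  rw [iPow, iPow, iPow, ← pow_add, ZMod.val_add, ← I_pow_eq_pow_mod]

@[simp] lemma iPow_zero : iPow 0 = 1 := by simp [iPow]

@[simp] lemma iPow_one : iPow 1 = I := by
  rw [iPow, show (1 : ZMod 4).val = 1 from rfl, pow_one]

@[simp] lemma iPow_two : iPow 2 = -1 := by
  rw [show (2 : ZMod 4) = 1 + 1 by decide, iPow_add]; simp

@[simp] lemma iPow_three : iPow 3 = -I := by
  rw [show (3 : ZMod 4) = 2 + 1 by decide, iPow_add]; simp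

lemma norm_iPow (k : ZMod 4) : ‖iPow k‖ = 1 := by simp [iPow]

lemma iPow_ne_zero (k : ZMod 4) : iPow k ≠ 0 := by simp [iPow]

lemma iPow_injective : Function.Injective iPow := by
  have h : ∀ k, iPow k = 1 → k = 0 := by
    intro k hk
    obtain rfl | rfl | rfl | rfl : k = 0 ∨ k = 1 ∨ k = 2 ∨ k = 3 := by
      clear hk; revert k; decide
    · rfl
    · simpa using congrArg Complex.im hk
    · have := congrArg Complex.re hk
      norm_num at this
    · simpa using congrArg Complex.im hk
  intro a b hab
  refine sub_eq_zero.1 (h _ ?_)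
  have := iPow_add (a - b) b
  rw [sub_add_cancel, hab] at this
  exact mul_right_cancel₀ (iPow_ne_zero b) (by rw [one_mul]; exact this.symm)

lemma thetaSq_S_slash (j : Fin 3) :
    thetaSq j ∣[(1 : ℤ)] S = iPow 3 • thetaSq (![0, 2, 1] j) := by
  funext z
  have hz := z.im_pos
  have hz0 := z.ne_zero
  have hS : ((S • z : ℍ) : ℂ) = -1 / (z : ℂ) := by
    rw [UpperHalfPlane.modular_S_smul]; simp [neg_div, one_div, inv_neg]
  have hd : UpperHalfPlane.denom S z = (z : ℂ) := by
    rw [ModularGroup.denom_apply]; simp [coe_S]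
  rw [ModularForm.SL_slash_apply, hd, iPow_three]
  have h1 := theta_neg_inv hz
  have h2 := phi_neg_inv hz
  have h3 := sq_cpow_half (-I * ((z : ℂ) / 2))
  set s := (-I * ((z : ℂ) / 2)) ^ (1 / 2 : ℂ)
  have hz1 : (z : ℂ) * (z : ℂ) ^ (-1 : ℤ) = 1 := by simp [hz0]
  -- All three functions are quadratic in θ and φ, so only the square of the root s occurs, and the
  -- weight one factor cancels its dependence on z.
  have key : s ^ 2 * (z : ℂ) ^ (-1 : ℤ) = -I / 2 := by
    rw [h3]; linear_combination (-I / 2) * hz1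
  fin_cases j <;> simp only [thetaSq, Matrix.cons_val, hS, h1, h2, Pi.smul_apply, smul_eq_mul,
    Fin.zero_eta, Fin.mk_one, Fin.reduceFinMk]
  · linear_combination (2 * (theta z ^ 2 + phi z ^ 2)) * key
  · linear_combination (4 * theta z * phi z) * key
  · linear_combination (2 * (theta z ^ 2 - phi z ^ 2)) * key

lemma thetaSq_T_slash (j : Fin 3) :
    thetaSq j ∣[(1 : ℤ)] T = iPow (![0, 0, 1] j) • thetaSq (![1, 0, 2] j) := by
  funext z
  have hz := z.im_pos
  have hT : ((T • z : ℍ) : ℂ) = (z : ℂ) + 1 := by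
    rw [UpperHalfPlane.modular_T_smul]; simp [add_comm]
  have hd : UpperHalfPlane.denom T z = 1 := by
    rw [ModularGroup.denom_apply]; simp [coe_T]
  rw [ModularForm.SL_slash_apply, hd, one_zpow, mul_one]
  have h2 := phi_add_one hz
  fin_cases j <;> simp only [thetaSq, Matrix.cons_val, hT, theta_add_one, h2, Pi.smul_apply,
    smul_eq_mul, Fin.zero_eta, Fin.mk_one, Fin.reduceFinMk, iPow_zero, iPow_one]
  · linear_combination phi z ^ 2 * I_sq
  · linear_combination -phi z ^ 2 * I_sq
  · ring

/-- The exponent `k` for which `i ^ k` is the constant term of `thetaSq j` at a cusp `a / c`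
(`none` if this constant term is zero). -/
def cuspExp : Fin 3 → ZMod 4 → ZMod 4 → Option (ZMod 4)
  | 0, a, c => if 2 * c = 0 then some (a - 1) else if 2 * a = 0 then some (-c) else none
  | 1, a, c => if 2 * c = 0 then some (a - 1 + c) else if 2 * a = 0 then none else some (-c)
  | 2, a, c => if 2 * c = 0 then none else if 2 * a = 0 then some (a - c) else some (a - 1)

/-- The permutation part of the monomial action of a matrix on `thetaSq`. -/
def slashIndex (j : Fin 3) (a b c d : ZMod 4) : Fin 3 :=
  -- The target is identified by where it vanishes: `thetaSq 2` at ∞, `thetaSq 1` at 0, `thetaSq 0`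
  -- at neither.
  if cuspExp j a c = none then 2 else if cuspExp j b d = none then 1 else 0

/-- The exponent of `i` in the monomial action of a matrix on `thetaSq`. -/
def slashExp (j : Fin 3) (a b c d : ZMod 4) : ZMod 4 :=
  -- If the constant term at ∞ vanishes, the exponent is read at 0; the shift by 1 undoes the factor
  -- i³ in the action of `S`. The inner default is never reached for determinant 1, since each j
  -- vanishes on a single parity class of columns and the two columns lie in different classes.
  (cuspExp j a c).getD ((cuspExp j b d).getD 0 + 1)

-- Together with the analogue for `T`, this makes the guessed formulas consistent with the action of
-- the generators; being about residues modulo 4, it is a finite check.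
set_option maxRecDepth 100000 in
lemma slash_cocycle_S : ∀ (j : Fin 3) (a b c d : ZMod 4), a * d - b * c = 1 →
    slashIndex j b (-a) d (-c) = ![0, 2, 1] (slashIndex j a b c d) ∧
    slashExp j b (-a) d (-c) = slashExp j a b c d + 3 := by
  decide

set_option maxRecDepth 100000 in
lemma slash_cocycle_T : ∀ (j : Fin 3) (a b c d : ZMod 4), a * d - b * c = 1 →
    slashIndex j a (a + b) c (c + d) = ![1, 0, 2] (slashIndex j a b c d) ∧
    slashExp j a (a + b) c (c + d) =
      slashExp j a b c d + ![0, 0, 1] (slashIndex j a b c d) := by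
  decide

/-- `γ` acts on `thetaSq` by the monomial matrix given by its residue class modulo `4`. -/
def IsMonomial (γ : SL(2, ℤ)) : Prop :=
  ∀ j, thetaSq j ∣[(1 : ℤ)] γ =
    iPow (slashExp j (γ 0 0 : ℤ) (γ 0 1 : ℤ) (γ 1 0 : ℤ) (γ 1 1 : ℤ)) •
      thetaSq (slashIndex j (γ 0 0 : ℤ) (γ 0 1 : ℤ) (γ 1 0 : ℤ) (γ 1 1 : ℤ))

lemma det_cast (R : Type*) [CommRing R] (γ : SL(2, ℤ)) :
    ((γ 0 0 : ℤ) : R) * (γ 1 1 : ℤ) - (γ 0 1 : ℤ) * (γ 1 0 : ℤ) = 1 := by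
  have := γ.det_coe
  rw [Matrix.det_fin_two] at this
  exact_mod_cast congrArg (Int.cast : ℤ → R) this

lemma slash_injective (k : ℤ) (γ : SL(2, ℤ)) :
    Function.Injective fun f : ℍ → ℂ => f ∣[k] γ := by
  intro f g h
  have := congrArg (fun f : ℍ → ℂ => f ∣[k] γ⁻¹) h
  simpa [← SlashAction.slash_mul] using this

lemma mul_S_apply (γ : SL(2, ℤ)) : (γ * S) 0 0 = γ 0 1 ∧ (γ * S) 0 1 = -γ 0 0 ∧
    (γ * S) 1 0 = γ 1 1 ∧ (γ * S) 1 1 = -γ 1 0 := by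
  simp [Matrix.SpecialLinearGroup.coe_mul, coe_S, Matrix.mul_apply, Fin.sum_univ_two]

lemma mul_T_apply (γ : SL(2, ℤ)) : (γ * T) 0 0 = γ 0 0 ∧ (γ * T) 0 1 = γ 0 0 + γ 0 1 ∧
    (γ * T) 1 0 = γ 1 0 ∧ (γ * T) 1 1 = γ 1 0 + γ 1 1 := by
  simp [Matrix.SpecialLinearGroup.coe_mul, coe_T, Matrix.mul_apply, Fin.sum_univ_two]

/-- Having an equivalence lets the induction over generators treat their inverses as well. -/
lemma isMonomial_mul_S_iff (γ : SL(2, ℤ)) : IsMonomial (γ * S) ↔ IsMonomial γ := by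
  have hc := fun j => slash_cocycle_S j _ _ _ _ (det_cast (ZMod 4) γ)
  obtain ⟨e00, e01, e10, e11⟩ := mul_S_apply γ
  refine forall_congr' fun j => ?_
  rw [e00, e01, e10, e11, Int.cast_neg, Int.cast_neg, (hc j).1, (hc j).2, iPow_add, mul_smul,
    ← thetaSq_S_slash, SlashAction.slash_mul, ← ModularForm.SL_smul_slash]
  exact (slash_injective _ _).eq_iff

lemma isMonomial_mul_T_iff (γ : SL(2, ℤ)) : IsMonomial (γ * T) ↔ IsMonomial γ := by
  have hc := fun j => slash_cocycle_T j _ _ _ _ (det_cast (ZMod 4) γ)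
  obtain ⟨e00, e01, e10, e11⟩ := mul_T_apply γ
  refine forall_congr' fun j => ?_
  rw [e00, e01, e10, e11, Int.cast_add, Int.cast_add, (hc j).1, (hc j).2, iPow_add, mul_smul,
    ← thetaSq_T_slash, SlashAction.slash_mul, ← ModularForm.SL_smul_slash]
  exact (slash_injective _ _).eq_iff

theorem isMonomial (γ : SL(2, ℤ)) : IsMonomial γ := by
  have hγ : γ ∈ Subgroup.closure {S, T} := by
    simp [SpecialLinearGroup.SL2Z_generators]
  induction hγ using Subgroup.closure_induction_right with
  | one =>
    intro j
    have h : slashExp j 1 0 0 1 = 0 ∧ slashIndex j 1 0 0 1 = j := by revert j; decide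
    simp [h.1, h.2]
  | mul_right x _ y hy ih =>
    rcases hy with rfl | rfl
    · exact (isMonomial_mul_S_iff x).2 ih
    · exact (isMonomial_mul_T_iff x).2 ih
  | mul_inv_cancel x _ y hy ih =>
    rcases hy with rfl | rfl
    · rw [← isMonomial_mul_S_iff, inv_mul_cancel_right]; exact ih
    · rw [← isMonomial_mul_T_iff, inv_mul_cancel_right]; exact ih

lemma thetaSq_slash_of_mem_Gamma_four {γ : SL(2, ℤ)} (hγ : γ ∈ CongruenceSubgroup.Gamma 4)
    (j : Fin 3) : thetaSq j ∣[(1 : ℤ)] γ = thetaSq j := by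
  have h : slashExp j 1 0 0 1 = 0 ∧ slashIndex j 1 0 0 1 = j := by revert j; decide
  rw [CongruenceSubgroup.Gamma_mem] at hγ
  rw [isMonomial γ j, hγ.1, hγ.2.1, hγ.2.2.1, hγ.2.2.2, h.1, h.2, iPow_zero, one_smul]

/-! ### Constant terms and absence of common zeros. -/

/-- The complex number `i ^ k` for `some k`, and `0` for `none`. -/
noncomputable def optPow (k : Option (ZMod 4)) : ℂ := k.elim 0 iPow

lemma iPow_slashExp_mul (j : Fin 3) (a b c d : ZMod 4) :
    iPow (slashExp j a b c d) * ![1, 1, 0] (slashIndex j a b c d) = optPow (cuspExp j a c) := by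
  unfold slashExp slashIndex
  cases h : cuspExp j a c with
  | none => simp [optPow]
  | some k => split_ifs <;> simp_all [optPow]

lemma tendsto_thetaSq (j : Fin 3) :
    Tendsto (thetaSq j) UpperHalfPlane.atImInfty (𝓝 (![1, 1, 0] j)) := by
  have him : Tendsto (fun z : ℍ => z.im) UpperHalfPlane.atImInfty atTop := tendsto_comap
  have h1 : Tendsto (fun z : ℍ => theta z) UpperHalfPlane.atImInfty (𝓝 1) := by
    simp_rw [theta_eq_jacobiTheta]
    refine tendsto_jacobiTheta_comap.comp (tendsto_comap_iff.2 ?_)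
    simpa [Function.comp_def] using him.const_mul_atTop two_pos
  have h2 : Tendsto (fun z : ℍ => theta z + phi z) UpperHalfPlane.atImInfty (𝓝 1) := by
    simp_rw [fun z : ℍ => theta_add_phi z.im_pos]
    refine tendsto_jacobiTheta_comap.comp (tendsto_comap_iff.2 ?_)
    simpa [Function.comp_def] using him.atTop_div_const two_pos
  have h3 : Tendsto (fun z : ℍ => phi z) UpperHalfPlane.atImInfty (𝓝 0) := by
    simpa using h2.sub h1
  fin_cases j
  · simpa [thetaSq] using (h1.pow 2).add (h3.pow 2)
  · simpa [thetaSq] using (h1.pow 2).sub (h3.pow 2)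
  · simpa [thetaSq] using (h1.const_mul 2).mul h3

/-- By monomiality a common zero propagates along its orbit, so it may be moved to height at least
1/2; there θ does not vanish. -/
lemma exists_thetaSq_ne_zero (z : ℍ) : ∃ j, thetaSq j z ≠ 0 := by
  by_contra! h
  obtain ⟨γ, hγ⟩ := exists_one_half_le_im_smul z
  have h0 : ∀ j, thetaSq j (γ • z) = 0 := by
    intro j
    have := congrFun (isMonomial γ j) z
    rw [ModularForm.SL_slash_apply, Pi.smul_apply, h, smul_zero, mul_eq_zero] at this
    exact this.resolve_right (zpow_ne_zero _ (UpperHalfPlane.denom_ne_zero _ z))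
  have h1 : theta (γ • z : ℍ) ^ 2 = 0 := by
    have e0 := h0 0
    have e1 := h0 1
    simp only [thetaSq, Matrix.cons_val] at e0 e1
    linear_combination (e0 + e1) / 2
  rw [sq_eq_zero_iff, theta_eq_jacobiTheta] at h1
  refine jacobiTheta_ne_zero_of_one_le_im ?_ h1
  have : (2 * ((γ • z : ℍ) : ℂ)).im = 2 * (γ • z : ℍ).im := by simp
  linarith

/-! ### The coordinates of F and their constant terms. -/

/-- The coefficients of `M`, `N`, `P` in terms of `thetaSq`. -/
noncomputable def formCoeff : Matrix (Fin 3) (Fin 3) ℂ :=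
  !![1 / 2, 1 / 2, 0; 0, 0, 1; 1 / 2, -1 / 2, 0]

lemma baseForm_eq_sum (i : Fin 3) : baseForm i = ∑ j, formCoeff i j • thetaSq j := by
  funext z
  fin_cases i <;> simp [baseForm, formCoeff, thetaSq, Fin.sum_univ_three] <;> ring

/-- The base change is invertible and the same in every block, so nonvanishing and proportionality
may be tested on `thetaSq`. -/
lemma formCoeff_sum_injective {x y : Fin 3 → ℂ}
    (h : ∀ i, ∑ j, formCoeff i j * x j = ∑ j, formCoeff i j * y j) : x = y := by
  have h0 := h 0
  have h1 := h 1
  have h2 := h 2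
  simp [formCoeff, Fin.sum_univ_three] at h0 h1 h2
  funext j
  fin_cases j
  · change x 0 = y 0
    linear_combination h0 + h2
  · change x 1 = y 1
    linear_combination h0 - h2
  · exact h1

lemma det_sMatrix_pos (p : ℕ) [Fact p.Prime] (o : Option (Fin p)) :
    0 < (sMatrix p o).det.val := by
  have : 0 < p := (Fact.out : p.Prime).pos
  cases o with
  | none => simp [sMatrix]
  | some t => simpa [sMatrix, Matrix.det_fin_two, Matrix.GeneralLinearGroup.mkOfDetNeZero] using this

lemma coordForm_eq_sum (p : ℕ) [Fact p.Prime] (i : Coord p) :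
    coordForm p i = ∑ j, formCoeff i.1 j • (thetaSq j ∣[(1 : ℤ)] sMatrix p i.2) := by
  rw [coordForm, baseForm_eq_sum, SlashAction.sum_slash]
  refine Finset.sum_congr rfl fun j _ => ?_
  rw [ModularForm.smul_slash, UpperHalfPlane.σ, if_pos (det_sMatrix_pos p i.2)]
  rfl

lemma coordForm_slash_eq_sum (p : ℕ) [Fact p.Prime] (i : Coord p) (γ : SL(2, ℤ)) :
    coordForm p i ∣[(1 : ℤ)] γ =
      ∑ j, formCoeff i.1 j • ((thetaSq j ∣[(1 : ℤ)] sMatrix p i.2) ∣[(1 : ℤ)] γ) := by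
  rw [coordForm_eq_sum, SlashAction.sum_slash]
  exact Finset.sum_congr rfl fun j _ => ModularForm.SL_smul_slash _ _ _ _

lemma tendsto_slash_upperTriangular {f : ℍ → ℂ} {l : ℂ}
    (hf : Tendsto f UpperHalfPlane.atImInfty (𝓝 l)) {A B D : ℝ} (hA : 0 < A) (hD : 0 < D)
    {g : GL (Fin 2) ℝ} (hg : (g : Matrix (Fin 2) (Fin 2) ℝ) = !![A, B; 0, D]) :
    Tendsto (f ∣[(1 : ℤ)] g) UpperHalfPlane.atImInfty (𝓝 (l / D)) := by
  have hdet : g.det.val = A * D := by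
    rw [Matrix.GeneralLinearGroup.val_det_apply, hg, Matrix.det_fin_two_of]; ring
  have hpos : 0 < g.det.val := by rw [hdet]; positivity
  have hden (z : ℍ) : UpperHalfPlane.denom g z = D := by simp [UpperHalfPlane.denom, hg]
  have him (z : ℍ) : (g • z).im = A / D * z.im := by
    rw [UpperHalfPlane.im_smul_eq_div_normSq, hden, hdet, abs_of_pos (mul_pos hA hD),
      Complex.normSq_ofReal]
    field_simp
  have hz : Tendsto (fun z : ℍ => z.im) UpperHalfPlane.atImInfty atTop := tendsto_comap
  have hsmul : Tendsto (fun z : ℍ => g • z) UpperHalfPlane.atImInfty UpperHalfPlane.atImInfty := by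
    refine tendsto_comap_iff.2 ?_
    simpa [Function.comp_def, him] using hz.const_mul_atTop (div_pos hA hD)
  refine ((hf.comp hsmul).div_const (D : ℂ)).congr fun z => ?_
  rw [ModularForm.slash_apply, hden, UpperHalfPlane.σ, if_pos hpos]
  simp [div_eq_mul_inv]

lemma tendsto_thetaSq_slash (j : Fin 3) (γ : SL(2, ℤ)) :
    Tendsto (thetaSq j ∣[(1 : ℤ)] γ) UpperHalfPlane.atImInfty
      (𝓝 (optPow (cuspExp j (γ 0 0 : ℤ) (γ 1 0 : ℤ)))) := by
  rw [isMonomial γ j, ← iPow_slashExp_mul j _ (γ 0 1 : ℤ) _ (γ 1 1 : ℤ)]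
  exact (tendsto_thetaSq _).const_mul _

/-- The matrix of determinant one with the given entries. -/
def mkSL {R : Type*} [CommRing R] (a b c d : R) (h : a * d - b * c = 1) :
    Matrix.SpecialLinearGroup (Fin 2) R :=
  ⟨!![a, b; c, d], by rw [Matrix.det_fin_two_of, h]⟩

section mkSL

variable {R : Type*} [CommRing R] (a b c d : R) (h : a * d - b * c = 1)

@[simp] lemma mkSL_zero_zero : mkSL a b c d h 0 0 = a := rfl

@[simp] lemma mkSL_zero_one : mkSL a b c d h 0 1 = b := rfl

@[simp] lemma mkSL_one_zero : mkSL a b c d h 1 0 = c := rfl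

@[simp] lemma mkSL_one_one : mkSL a b c d h 1 1 = d := rfl

end mkSL

/-- The four equations are the entries of (1 t; 0 p)γ = δg, which replaces a determinant p slash by
one from SL(2, ℤ) followed by an upper triangular one. -/
lemma slash_sMatrix_some_slash (f : ℍ → ℂ) (p : ℕ) [Fact p.Prime] (t : Fin p) (γ : SL(2, ℤ))
    {a b c d A B D : ℤ} (h : a * d - b * c = 1) {g : GL (Fin 2) ℝ}
    (hg : (g : Matrix (Fin 2) (Fin 2) ℝ) = !![(A : ℝ), (B : ℝ); 0, (D : ℝ)])
    (h00 : γ 0 0 + t * γ 1 0 = a * A) (h01 : γ 0 1 + t * γ 1 1 = a * B + b * D)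
    (h10 : p * γ 1 0 = c * A) (h11 : p * γ 1 1 = c * B + d * D) :
    (f ∣[(1 : ℤ)] sMatrix p (some t)) ∣[(1 : ℤ)] γ =
      (f ∣[(1 : ℤ)] mkSL a b c d h) ∣[(1 : ℤ)] g := by
  have c00 := congrArg (Int.cast : ℤ → ℝ) h00
  have c01 := congrArg (Int.cast : ℤ → ℝ) h01
  have c10 := congrArg (Int.cast : ℤ → ℝ) h10
  have c11 := congrArg (Int.cast : ℤ → ℝ) h11
  push_cast at c00 c01 c10 c11
  rw [ModularForm.SL_slash, ModularForm.SL_slash, ← SlashAction.slash_mul,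
    ← SlashAction.slash_mul]
  congr 1
  ext i j
  rw [Matrix.GeneralLinearGroup.coe_mul, Matrix.GeneralLinearGroup.coe_mul, hg]
  fin_cases i <;> fin_cases j <;>
    simp [sMatrix, Matrix.GeneralLinearGroup.mkOfDetNeZero, Matrix.mul_apply,
      Fin.sum_univ_two] <;>
    assumption

/-- The constant terms of `thetaSq j ∣ α` at a cusp `a / c`, for `α ∈ S`. -/
noncomputable def cuspCoord (p : ℕ) (a c : ℤ) (j : Fin 3) : Option (Fin p) → ℂ
  | none => optPow (cuspExp j a c)
  | some t =>
    if (p : ℤ) ∣ a + t * c then optPow (cuspExp j (p * (a + (t : ℕ) * c)) c)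
    else optPow (cuspExp j (a + (t : ℕ) * c) (p * c)) / p

lemma natCast_sq_zmod_four {p : ℕ} (hp : Odd p) : ((p : ZMod 4)) ^ 2 = 1 := by
  obtain ⟨k, rfl⟩ := hp
  have : ∀ x : ZMod 4, (2 * x + 1) ^ 2 = 1 := by decide
  push_cast
  exact this k

lemma tendsto_thetaSq_sMatrix {p : ℕ} [Fact p.Prime] (hp : Odd p) (γ : SL(2, ℤ)) (j : Fin 3)
    (o : Option (Fin p)) :
    Tendsto ((thetaSq j ∣[(1 : ℤ)] sMatrix p o) ∣[(1 : ℤ)] γ) UpperHalfPlane.atImInfty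
      (𝓝 (cuspCoord p (γ 0 0) (γ 1 0) j o)) := by
  cases o with
  | none =>
    rw [sMatrix, SlashAction.slash_one]
    exact tendsto_thetaSq_slash j γ
  | some t =>
    have hp0 : (0 : ℝ) < p := by exact_mod_cast (Fact.out : p.Prime).pos
    have hdet := γ.det_coe
    rw [Matrix.det_fin_two] at hdet
    set a := γ 0 0
    set b := γ 0 1
    set c := γ 1 0
    set d := γ 1 1
    rw [cuspCoord]
    split_ifs with h
    · obtain ⟨m, hm⟩ := h
      have h1 : m * (p * d) - (b + t * d) * c = 1 := by
        linear_combination hdet - d * hm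
      rw [slash_sMatrix_some_slash _ p t γ h1
        (g := Matrix.GeneralLinearGroup.mkOfDetNeZero !![(p : ℝ), 0; 0, 1]
          (by simp [Matrix.det_fin_two, hp0.ne'])) (A := p) (B := 0) (D := 1)
          (by simp [Matrix.GeneralLinearGroup.mkOfDetNeZero])
          (by linear_combination hm)
          (by ring) (by ring) (by ring)]
      have hl := tendsto_slash_upperTriangular
        (tendsto_thetaSq_slash j (mkSL m (b + t * d) c (p * d) h1))
        (B := 0) hp0 one_pos
        (g := Matrix.GeneralLinearGroup.mkOfDetNeZero !![(p : ℝ), 0; 0, 1]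
          (by simp [Matrix.det_fin_two, hp0.ne']))
        (by simp [Matrix.GeneralLinearGroup.mkOfDetNeZero])
      -- Here a + tc = pm, and p is its own inverse modulo 4.
      have hcast : (p : ZMod 4) * ((a : ZMod 4) + ((t : ℕ) : ZMod 4) * (c : ZMod 4)) = m := by
        have := congrArg (Int.cast : ℤ → ZMod 4) hm
        push_cast at this
        rw [this]
        linear_combination (m : ZMod 4) * natCast_sq_zmod_four hp
      rw [hcast]
      simpa using hl
    · obtain ⟨x, y, hxy⟩ : IsCoprime (p : ℤ) (a + t * c) :=
        (Nat.prime_iff_prime_int.1 (Fact.out : p.Prime)).coprime_iff_not_dvd.2 h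
      -- Since a + tc is invertible modulo p, B can be chosen to make the upper right entry of δ
      -- integral.
      obtain ⟨B, e, hB⟩ : ∃ B e : ℤ, b + t * d = (a + t * c) * B + e * p :=
        ⟨y * (b + t * d), x * (b + t * d), by linear_combination -(b + t * d) * hxy⟩
      have h1 : (a + t * c) * (d - B * c) - e * (p * c) = 1 := by
        linear_combination hdet + c * hB
      rw [slash_sMatrix_some_slash _ p t γ h1
        (g := Matrix.GeneralLinearGroup.mkOfDetNeZero !![1, (B : ℝ); 0, (p : ℝ)]
          (by simp [Matrix.det_fin_two, hp0.ne'])) (A := 1) (B := B) (D := p)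
          (by simp [Matrix.GeneralLinearGroup.mkOfDetNeZero])
          (by ring)
          (by linear_combination hB)
          (by ring)
          (by ring)]
      have hl := tendsto_slash_upperTriangular
        (tendsto_thetaSq_slash j (mkSL (a + t * c) e (p * c) (d - B * c) h1))
        (B := B) one_pos hp0
        (g := Matrix.GeneralLinearGroup.mkOfDetNeZero !![1, (B : ℝ); 0, (p : ℝ)]
          (by simp [Matrix.det_fin_two, hp0.ne']))
        (by simp [Matrix.GeneralLinearGroup.mkOfDetNeZero])
      simpa using hl

/-- The constant terms of the homogeneous coordinates of `F` at a cusp `a / c`. -/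
noncomputable def cuspVec (p : ℕ) (a c : ℤ) (i : Coord p) : ℂ :=
  ∑ j, formCoeff i.1 j * cuspCoord p a c j i.2

theorem tendsto_coordForm_slash {p : ℕ} [Fact p.Prime] (hp : Odd p) (γ : SL(2, ℤ)) (i : Coord p) :
    Tendsto (coordForm p i ∣[(1 : ℤ)] γ) UpperHalfPlane.atImInfty
      (𝓝 (cuspVec p (γ 0 0) (γ 1 0) i)) := by
  rw [coordForm_slash_eq_sum]
  have := tendsto_finsetSum Finset.univ fun j _ =>
    (tendsto_thetaSq_sMatrix hp γ j i.2).const_mul (formCoeff i.1 j)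
  refine this.congr fun z => ?_
  simp [Finset.sum_apply]

lemma exists_coordForm_ne_zero (p : ℕ) [Fact p.Prime] (z : ℍ) :
    (fun i => coordForm p i z) ≠ 0 := by
  intro h
  obtain ⟨j, hj⟩ := exists_thetaSq_ne_zero z
  refine hj ?_
  have : (fun j => thetaSq j z) = 0 := by
    refine formCoeff_sum_injective fun i => ?_
    have := congrFun h (i, none)
    simpa [coordForm_eq_sum, sMatrix, Finset.sum_apply] using this
  exact congrFun this j

theorem coordForm_slash_of_mem_gammaPM {p : ℕ} [Fact p.Prime] (hp : Odd p) {β : SL(2, ℤ)}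
    (hβ : β ∈ gammaPM p) (i : Coord p) : coordForm p i ∣[(1 : ℤ)] β = coordForm p i := by
  rw [coordForm_slash_eq_sum, coordForm_eq_sum]
  refine Finset.sum_congr rfl fun j _ => ?_
  congr 1
  obtain ⟨f, o⟩ := i
  cases o with
  | none => simpa [sMatrix] using thetaSq_slash_of_mem_Gamma_four hβ.1 j
  | some t =>
    have hdet := β.det_coe
    rw [Matrix.det_fin_two] at hdet
    -- The quotient e is the upper right entry of αβα⁻¹; it is integral because β is scalar modulo
    -- p.
    obtain ⟨e, he⟩ : (p : ℤ) ∣ β 0 1 + t * (β 1 1 - β 0 0) - t ^ 2 * β 1 0 := by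
      rw [← ZMod.intCast_zmod_eq_zero_iff_dvd]
      have hent : ((β 0 1 : ℤ) : ZMod p) = 0 ∧ ((β 1 0 : ℤ) : ZMod p) = 0 ∧
          ((β 1 1 : ℤ) : ZMod p) = (β 0 0 : ℤ) := by
        have hr : ∀ i k, ((β i k : ℤ) : ZMod p) = reduce p β i k := fun i k => rfl
        rcases hβ.2 with h | h <;> simp [hr, h]
      push_cast
      rw [hent.1, hent.2.1, hent.2.2]
      ring
    have h1 : (β 0 0 + t * β 1 0) * (β 1 1 - t * β 1 0) - e * (p * β 1 0) = 1 := by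
      linear_combination hdet + β 1 0 * he
    have h4 := CongruenceSubgroup.Gamma_mem.1 hβ.1
    have hmem : mkSL (β 0 0 + t * β 1 0) e (p * β 1 0) (β 1 1 - t * β 1 0) h1 ∈
        CongruenceSubgroup.Gamma 4 := by
      have he4 : ((e : ℤ) : ZMod 4) = 0 := by
        have := congrArg (Int.cast : ℤ → ZMod 4) he
        push_cast at this
        rw [h4.1, h4.2.1, h4.2.2.1, h4.2.2.2] at this
        linear_combination (-(p : ZMod 4)) * this - (e : ZMod 4) * natCast_sq_zmod_four hp
      rw [CongruenceSubgroup.Gamma_mem]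
      simp [h4.1, h4.2.2.1, h4.2.2.2, he4]
    rw [slash_sMatrix_some_slash _ p t β h1 (g := sMatrix p (some t)) (A := 1) (B := t) (D := p)
        (by simp [sMatrix, Matrix.GeneralLinearGroup.mkOfDetNeZero])
        (by simp)
        (by linear_combination he)
        (by simp)
        (by ring),
      thetaSq_slash_of_mem_Gamma_four hmem j]

/-! ### Recovering a cusp from its constant terms. -/

lemma cuspExp_neg : ∀ (j : Fin 3) (a c : ZMod 4), ¬ (2 * a = 0 ∧ 2 * c = 0) →
    cuspExp j (-a) (-c) = (cuspExp j a c).map (· + 2) := by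
  decide

lemma exists_cuspExp_ne_none : ∀ a c : ZMod 4, ∃ j, cuspExp j a c ≠ none := by
  decide

set_option maxRecDepth 100000 in
lemma eq_or_eq_neg_of_cuspExp : ∀ a c a' c' : ZMod 4, ¬ (2 * a = 0 ∧ 2 * c = 0) →
    ¬ (2 * a' = 0 ∧ 2 * c' = 0) → ∀ k : ZMod 4,
    (∀ j, cuspExp j a' c' = (cuspExp j a c).map (· + k)) →
    (a' = a ∧ c' = c) ∨ (a' = -a ∧ c' = -c) := by
  decide

lemma optPow_map_add (x : Option (ZMod 4)) (k : ZMod 4) :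
    optPow (x.map (· + k)) = iPow k * optPow x := by
  cases x <;> simp [optPow, iPow_add, mul_comm]

lemma optPow_eq_zero_iff (x : Option (ZMod 4)) : optPow x = 0 ↔ x = none := by
  cases x <;> simp [optPow, iPow_ne_zero]

lemma optPow_injective : Function.Injective optPow := by
  intro x y h
  cases x with
  | none => exact ((optPow_eq_zero_iff y).1 h.symm).symm
  | some x =>
    cases y with
    | none => exact (optPow_eq_zero_iff _).1 h
    | some y => exact congrArg some (iPow_injective h)

lemma norm_optPow {x : Option (ZMod 4)} (h : x ≠ none) : ‖optPow x‖ = 1 := by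
  cases x with
  | none => exact absurd rfl h
  | some x => exact norm_iPow x

lemma not_even_of_isCoprime {a c : ℤ} (h : IsCoprime a c) :
    ¬ (2 * (a : ZMod 4) = 0 ∧ 2 * (c : ZMod 4) = 0) := by
  rintro ⟨ha, hc⟩
  obtain ⟨x, y, hxy⟩ := h
  have := congrArg (Int.cast : ℤ → ZMod 4) hxy
  push_cast at this
  have h2 : (2 : ZMod 4) = 0 := by
    linear_combination (-2 : ZMod 4) * this + (x : ZMod 4) * ha + (y : ZMod 4) * hc
  exact absurd h2 (by decide)

lemma not_even_mul_add {p t a c : ZMod 4} (hp : p ^ 2 = 1) (h : ¬ (2 * a = 0 ∧ 2 * c = 0)) :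
    ¬ (2 * (p * (a + t * c)) = 0 ∧ 2 * c = 0) := by
  rintro ⟨h1, h2⟩
  exact h ⟨by linear_combination p * h1 - 2 * (a + t * c) * hp - t * h2, h2⟩

lemma not_even_add_mul {p t a c : ZMod 4} (hp : p ^ 2 = 1) (h : ¬ (2 * a = 0 ∧ 2 * c = 0)) :
    ¬ (2 * (a + t * c) = 0 ∧ 2 * (p * c) = 0) := by
  rintro ⟨h1, h2⟩
  have h3 : 2 * c = 0 := by linear_combination p * h2 - 2 * c * hp
  exact h ⟨by linear_combination h1 - t * h3, h3⟩

lemma dvd_add_mul_iff (p : ℕ) (a c : ℤ) (t : ℕ) :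
    (p : ℤ) ∣ a + t * c ↔ (a : ZMod p) + t * (c : ZMod p) = 0 := by
  rw [← ZMod.intCast_zmod_eq_zero_iff_dvd]
  push_cast
  rfl

/-- Two integral vectors agree modulo `4` and modulo `p` up to units. -/
def UnitRel (p : ℕ) (a c a' c' : ℤ) : Prop :=
  (∃ ε : (ZMod 4)ˣ, (a' : ZMod 4) = ε * a ∧ (c' : ZMod 4) = ε * c) ∧
    ∃ μ : (ZMod p)ˣ, (a' : ZMod p) = μ * a ∧ (c' : ZMod p) = μ * c

lemma units_zmod_four (ε : (ZMod 4)ˣ) : (ε : ZMod 4) = 1 ∨ (ε : ZMod 4) = -1 := by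
  revert ε; decide

/-- Modulo p only the conditions p ∣ a + tc matter, and they ignore units; a sign change modulo 4
multiplies every coordinate by -1. -/
lemma cuspCoord_of_unitRel {p : ℕ} (hp : Odd p) {a c a' c' : ℤ} (hac : IsCoprime a c)
    (h : UnitRel p a c a' c') :
    ∃ s : ℂ, s ≠ 0 ∧ ∀ j o, cuspCoord p a' c' j o = s * cuspCoord p a c j o := by
  obtain ⟨⟨ε, ha, hc⟩, μ, hma, hmc⟩ := h
  have hdvd (t : Fin p) : (p : ℤ) ∣ a' + (t : ℕ) * c' ↔ (p : ℤ) ∣ a + (t : ℕ) * c := by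
    rw [dvd_add_mul_iff, dvd_add_mul_iff, hma, hmc, mul_left_comm, ← mul_add]
    exact Units.mul_right_eq_zero μ
  have hprim := not_even_of_isCoprime hac
  have hp2 := natCast_sq_zmod_four hp
  rcases units_zmod_four ε with hε | hε
  · refine ⟨1, one_ne_zero, fun j o => ?_⟩
    rw [hε, one_mul] at ha hc
    cases o <;> simp [cuspCoord, hdvd, ha, hc]
  · refine ⟨iPow 2, iPow_ne_zero 2, fun j o => ?_⟩
    rw [hε, neg_one_mul] at ha hc
    cases o with
    | none => rw [cuspCoord, cuspCoord, ha, hc, cuspExp_neg j _ _ hprim, optPow_map_add]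
    | some t =>
      rw [cuspCoord, cuspCoord, ha, hc]
      simp only [hdvd]
      split_ifs with h
      · rw [← optPow_map_add, ← cuspExp_neg j _ _ (not_even_mul_add hp2 hprim)]
        ring_nf
      · rw [mul_div_assoc', ← optPow_map_add, ← cuspExp_neg j _ _ (not_even_add_mul hp2 hprim)]
        ring_nf

/-- The root set in t is {-a/c}, or empty when c = 0, so it determines the point (a : c) of the
projective line. -/
lemma exists_unit_of_forall_add_mul_eq_zero_iff {K : Type*} [Field K] {a c a' c' : K}
    (h0 : ¬ (a = 0 ∧ c = 0)) (h0' : ¬ (a' = 0 ∧ c' = 0))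
    (h : ∀ t : K, a' + t * c' = 0 ↔ a + t * c = 0) :
    ∃ μ : Kˣ, a' = μ * a ∧ c' = μ * c := by
  by_cases hc : c = 0
  · subst hc
    have ha : a ≠ 0 := fun ha => h0 ⟨ha, rfl⟩
    have hc' : c' = 0 := by
      by_contra hc'
      have := (h (-a' / c')).1 (by field_simp; ring)
      exact ha (by simpa using this)
    have ha' : a' ≠ 0 := fun ha => h0' ⟨ha, hc'⟩
    exact ⟨Units.mk0 (a' / a) (div_ne_zero ha' ha), by simp [ha], by simp [hc']⟩
  · have ht := (h (-a / c)).2 (by field_simp; ring)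
    have hc' : c' ≠ 0 := by
      rintro rfl
      exact h0' ⟨by simpa using ht, rfl⟩
    refine ⟨Units.mk0 (c' / c) (div_ne_zero hc' hc), ?_, by simp [hc]⟩
    rw [Units.val_mk0]
    field_simp at ht ⊢
    linear_combination ht

lemma intCast_not_both_zero {p : ℕ} (hp : p ≠ 1) {a c : ℤ} (h : IsCoprime a c) :
    ¬ ((a : ZMod p) = 0 ∧ (c : ZMod p) = 0) := by
  rintro ⟨ha, hc⟩
  rw [ZMod.intCast_zmod_eq_zero_iff_dvd] at ha hc
  have := Int.isUnit_iff_natAbs_eq.1 (h.isUnit_of_dvd' ha hc)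
  exact hp (by simpa using this)

lemma norm_cuspCoord_some {p : ℕ} {a c : ℤ} {j : Fin 3} {t : Fin p}
    (h : cuspCoord p a c j (some t) ≠ 0) :
    ‖cuspCoord p a c j (some t)‖ = if (p : ℤ) ∣ a + (t : ℕ) * c then 1 else (p : ℝ)⁻¹ := by
  rw [cuspCoord] at h ⊢
  split_ifs at h ⊢ with hd
  · exact norm_optPow fun hn => h ((optPow_eq_zero_iff _).2 hn)
  · rw [norm_div, norm_optPow fun hn => h (by rw [(optPow_eq_zero_iff _).2 hn, zero_div])]
    simp

lemma exists_cuspCoord_ne_zero {p : ℕ} (hp : p ≠ 0) (a c : ℤ) (o : Option (Fin p)) :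
    ∃ j, cuspCoord p a c j o ≠ 0 := by
  have hp' : (p : ℂ) ≠ 0 := by exact_mod_cast hp
  cases o with
  | none =>
    simp only [cuspCoord, ne_eq, optPow_eq_zero_iff]
    exact exists_cuspExp_ne_none _ _
  | some t =>
    by_cases h : (p : ℤ) ∣ a + (t : ℕ) * c <;>
      simp only [cuspCoord, h, if_true, if_false, ne_eq, div_eq_zero_iff, optPow_eq_zero_iff, hp',
        or_false] <;>
      exact exists_cuspExp_ne_none _ _

lemma unitRel_of_cuspCoord {p : ℕ} [Fact p.Prime] {a c a' c' : ℤ}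
    (hac : IsCoprime a c) (hac' : IsCoprime a' c') {s : ℂ}
    (h : ∀ j o, cuspCoord p a' c' j o = s * cuspCoord p a c j o) : UnitRel p a c a' c' := by
  have hp1 : 1 < p := (Fact.out : p.Prime).one_lt
  -- In the block α = 1 the nonzero coordinates are powers of i, so their ratio is one too.
  obtain ⟨k, rfl⟩ : ∃ k, s = iPow k := by
    obtain ⟨j, hj⟩ := exists_cuspExp_ne_none a' c'
    have h0 := h j none
    simp only [cuspCoord] at h0
    cases hx' : cuspExp j a' c' with
    | none => exact absurd hx' hj
    | some x' =>
      cases hx : cuspExp j a c with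
      | none => simp [hx', hx, optPow, iPow_ne_zero] at h0
      | some x =>
        refine ⟨x' - x, mul_right_cancel₀ (iPow_ne_zero x) ?_⟩
        rw [← iPow_add, sub_add_cancel]
        simpa [hx', hx, optPow] using h0.symm
  constructor
  · have hk (j : Fin 3) : cuspExp j a' c' = (cuspExp j a c).map (· + k) :=
      optPow_injective (by rw [optPow_map_add]; exact h j none)
    rcases eq_or_eq_neg_of_cuspExp _ _ _ _ (not_even_of_isCoprime hac)
      (not_even_of_isCoprime hac') k hk with h | h
    · exact ⟨1, by simpa using h⟩
    · exact ⟨-1, by simpa using h⟩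
  · refine exists_unit_of_forall_add_mul_eq_zero_iff (intCast_not_both_zero hp1.ne' hac)
      (intCast_not_both_zero hp1.ne' hac') fun x => ?_
    let t : Fin p := ⟨x.val, x.val_lt⟩
    have hx : ((t : ℕ) : ZMod p) = x := ZMod.natCast_zmod_val x
    rw [← hx, ← dvd_add_mul_iff, ← dvd_add_mul_iff]
    obtain ⟨j, hj⟩ := exists_cuspCoord_ne_zero (p := p) (by lia) a' c' (some t)
    have e := h j (some t)
    have hj' : cuspCoord p a c j (some t) ≠ 0 := fun h0 => hj (by rw [e, h0, mul_zero])
    -- The scalar has absolute value 1, so the values 1 and 1/p cannot be confused.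
    have hn := congrArg norm e
    rw [norm_mul, norm_iPow, one_mul, norm_cuspCoord_some hj, norm_cuspCoord_some hj'] at hn
    have hinv : ((p : ℝ)⁻¹) < 1 := inv_lt_one_of_one_lt₀ (by exact_mod_cast hp1)
    split_ifs at hn with h1 h2 h2
    · exact iff_of_true h1 h2
    · exact absurd hn hinv.ne'
    · exact absurd hn hinv.ne
    · exact iff_of_false h1 h2

lemma cuspVec_ne_zero {p : ℕ} (hp : p ≠ 0) (a c : ℤ) : cuspVec p a c ≠ 0 := by
  intro h
  obtain ⟨j, hj⟩ := exists_cuspCoord_ne_zero hp a c none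
  refine hj ?_
  have : (fun j => cuspCoord p a c j none) = 0 :=
    formCoeff_sum_injective fun i => by simpa [cuspVec] using congrFun h (i, none)
  exact congrFun this j

theorem mk_cuspVec_eq_iff {p : ℕ} [Fact p.Prime] (hp : Odd p) {a c a' c' : ℤ}
    (hac : IsCoprime a c) (hac' : IsCoprime a' c') (h0 : cuspVec p a c ≠ 0)
    (h0' : cuspVec p a' c' ≠ 0) :
    Projectivization.mk ℂ (cuspVec p a c) h0 = Projectivization.mk ℂ (cuspVec p a' c') h0' ↔
      UnitRel p a c a' c' := by
  rw [eq_comm, Projectivization.mk_eq_mk_iff']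
  constructor
  · rintro ⟨s, hs⟩
    refine unitRel_of_cuspCoord hac hac' (s := s) fun j o => ?_
    have : (fun j => cuspCoord p a' c' j o) = fun j => s * cuspCoord p a c j o := by
      refine formCoeff_sum_injective fun i => ?_
      have := congrFun hs (i, o)
      simp only [Pi.smul_apply, cuspVec, smul_eq_mul, Finset.mul_sum] at this
      rw [← this]
      exact Finset.sum_congr rfl fun j _ => by ring
    exact congrFun this j
  · intro h
    obtain ⟨s, -, hs⟩ := cuspCoord_of_unitRel hp hac h
    refine ⟨s, funext fun i => ?_⟩
    simp only [Pi.smul_apply, cuspVec, smul_eq_mul, Finset.mul_sum]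
    exact Finset.sum_congr rfl fun j _ => by rw [hs]; ring

lemma unitRel_iff_exists_unit {p : ℕ} (hp : Odd p) (a c a' c' : ℤ) :
    UnitRel p a c a' c' ↔ ∃ μ : (ZMod (4 * p))ˣ,
      (a' : ZMod (4 * p)) = μ * (a : ZMod (4 * p)) ∧
      (c' : ZMod (4 * p)) = μ * (c : ZMod (4 * p)) := by
  have hcop : Nat.Coprime 4 p := by
    rw [show 4 = 2 ^ 2 by norm_num]
    exact Nat.Coprime.pow_left 2 (Nat.coprime_two_left.2 hp)
  let e := ZMod.chineseRemainder hcop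
  have key (μ : ZMod (4 * p)) (x x' : ℤ) : (x' : ZMod (4 * p)) = μ * (x : ZMod (4 * p)) ↔
      (x' : ZMod 4) = (e μ).1 * x ∧ (x' : ZMod p) = (e μ).2 * x := by
    rw [← e.injective.eq_iff, map_mul, map_intCast, map_intCast, Prod.ext_iff]
    simp
  constructor
  · rintro ⟨⟨ε, ha, hc⟩, μ, ha', hc'⟩
    let u := (Units.mapEquiv e.toMulEquiv).symm (MulEquiv.prodUnits.symm (ε, μ))
    have hu : e (u : ZMod (4 * p)) = ((ε : ZMod 4), (μ : ZMod p)) := by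
      have : (u : ZMod (4 * p)) = e.symm ((ε : ZMod 4), (μ : ZMod p)) := rfl
      rw [this, RingEquiv.apply_symm_apply]
    exact ⟨u, (key _ _ _).2 (by rw [hu]; exact ⟨ha, ha'⟩),
      (key _ _ _).2 (by rw [hu]; exact ⟨hc, hc'⟩)⟩
  · rintro ⟨u, ha, hc⟩
    let w := MulEquiv.prodUnits (Units.mapEquiv e.toMulEquiv u)
    exact ⟨⟨w.1, ((key _ _ _).1 ha).1, ((key _ _ _).1 hc).1⟩,
      w.2, ((key _ _ _).1 ha).2, ((key _ _ _).1 hc).2⟩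

/-! ### Cusps as orbits of `∞` -/

lemma smul_infty_eq_ratCusp (γ : SL(2, ℤ)) :
    γ • (OnePoint.infty : OnePoint ℚ) = ratCusp (γ 0 0) (γ 1 0) := by
  change Matrix.SpecialLinearGroup.mapGL ℚ γ • (OnePoint.infty : OnePoint ℚ) = _
  rw [OnePoint.smul_infty_eq_ite, ratCusp]
  simp

lemma exists_first_column {a c : ℤ} (h : IsCoprime a c) :
    ∃ γ : SL(2, ℤ), γ 0 0 = a ∧ γ 1 0 = c := by
  obtain ⟨x, y, hxy⟩ := h
  exact ⟨mkSL a (-y) c x (by linear_combination hxy), rfl, rfl⟩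

lemma isCoprime_first_column (γ : SL(2, ℤ)) : IsCoprime (γ 0 0) (γ 1 0) := by
  have h := γ.det_coe
  rw [Matrix.det_fin_two] at h
  exact ⟨γ 1 1, -γ 0 1, by linear_combination h⟩

lemma exists_smul_infty_eq (x : OnePoint ℚ) :
    ∃ γ : SL(2, ℤ), γ • (OnePoint.infty : OnePoint ℚ) = x := by
  cases x with
  | infty => exact ⟨1, one_smul _ _⟩
  | coe q =>
    obtain ⟨γ, h0, h1⟩ := exists_first_column (Rat.isCoprime_num_den q)
    refine ⟨γ, ?_⟩
    rw [smul_infty_eq_ratCusp, h0, h1, ratCusp, if_neg (by exact_mod_cast q.den_ne_zero)]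
    exact congrArg _ (by exact_mod_cast q.num_div_den)

lemma smul_infty_eq_infty_iff (γ : SL(2, ℤ)) :
    γ • (OnePoint.infty : OnePoint ℚ) = OnePoint.infty ↔ γ 1 0 = 0 := by
  rw [smul_infty_eq_ratCusp, ratCusp]
  split_ifs with h <;> simp [h]

/-- The quotient γ⁻¹γ' fixes ∞, so it is upper triangular with a unit on the diagonal. -/
lemma first_column_of_smul_infty_eq {γ γ' : SL(2, ℤ)}
    (h : γ • (OnePoint.infty : OnePoint ℚ) = γ' • (OnePoint.infty : OnePoint ℚ)) :
    ∃ s : ℤˣ, γ' 0 0 = s * γ 0 0 ∧ γ' 1 0 = s * γ 1 0 := by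
  have h0 : (γ⁻¹ * γ') 1 0 = 0 := by
    rw [← smul_infty_eq_infty_iff, mul_smul, ← h, inv_smul_smul]
  have hdet := (γ⁻¹ * γ').det_coe
  rw [Matrix.det_fin_two, h0, mul_zero, sub_zero] at hdet
  refine ⟨Units.mkOfMulEqOne _ _ hdet, ?_⟩
  have hmul : γ' = γ * (γ⁻¹ * γ') := by group
  have e (i : Fin 2) : γ' i 0 = γ i 0 * (γ⁻¹ * γ') 0 0 + γ i 1 * (γ⁻¹ * γ') 1 0 := by
    conv_lhs => rw [hmul]
    rw [Matrix.SpecialLinearGroup.coe_mul, Matrix.mul_apply, Fin.sum_univ_two]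
  constructor <;> rw [e, h0, Units.val_mkOfMulEqOne] <;> ring

/-- Two integral vectors agree up to sign modulo `4` and up to sign modulo `p`. -/
def SignRel (p : ℕ) (a c a' c' : ℤ) : Prop :=
  (∃ ε : (ZMod 4)ˣ, (a' : ZMod 4) = ε * a ∧ (c' : ZMod 4) = ε * c) ∧
    ∃ ν : ℤˣ, (a' : ZMod p) = (ν : ℤ) * a ∧ (c' : ZMod p) = (ν : ℤ) * c

lemma SignRel.unitRel {p : ℕ} {a c a' c' : ℤ} (h : SignRel p a c a' c') :
    UnitRel p a c a' c' :=
  ⟨h.1, by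
    obtain ⟨ν, h⟩ := h.2
    exact ⟨Units.map (Int.castRingHom (ZMod p)).toMonoidHom ν, h⟩⟩

lemma intCast_first_column_mul {R : Type*} [CommRing R] (β γ : SL(2, ℤ)) {e : R}
    (h00 : ((β 0 0 : ℤ) : R) = e) (h01 : ((β 0 1 : ℤ) : R) = 0)
    (h10 : ((β 1 0 : ℤ) : R) = 0) (h11 : ((β 1 1 : ℤ) : R) = e) (i : Fin 2) :
    (((β * γ) i 0 : ℤ) : R) = e * (γ i 0 : ℤ) := by
  rw [Matrix.SpecialLinearGroup.coe_mul, Matrix.mul_apply, Fin.sum_univ_two]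
  fin_cases i <;> simp [h00, h01, h10, h11]

lemma intCast_inv_mul {R : Type*} [CommRing R] {γ γ' : SL(2, ℤ)} {s : R} (hs : s * s = 1)
    (h0 : ((γ' 0 0 : ℤ) : R) = s * (γ 0 0 : ℤ)) (h1 : ((γ' 1 0 : ℤ) : R) = s * (γ 1 0 : ℤ)) :
    (((γ⁻¹ * γ') 0 0 : ℤ) : R) = s ∧ (((γ⁻¹ * γ') 1 0 : ℤ) : R) = 0 ∧
      (((γ⁻¹ * γ') 1 1 : ℤ) : R) = s := by
  have hd := det_cast R γ
  have hd' := det_cast R (γ⁻¹ * γ')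
  have e0 : (((γ⁻¹ * γ') 0 0 : ℤ) : R) = s := by
    rw [Matrix.SpecialLinearGroup.coe_mul, Matrix.mul_apply, Fin.sum_univ_two]
    simp [Matrix.SpecialLinearGroup.SL2_inv_expl, h0, h1]
    linear_combination s * hd
  have e1 : (((γ⁻¹ * γ') 1 0 : ℤ) : R) = 0 := by
    rw [Matrix.SpecialLinearGroup.coe_mul, Matrix.mul_apply, Fin.sum_univ_two]
    simp [Matrix.SpecialLinearGroup.SL2_inv_expl, h0, h1]
    ring
  refine ⟨e0, e1, ?_⟩
  rw [e0, e1] at hd'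
  linear_combination s * hd' - (((γ⁻¹ * γ') 1 1 : ℤ) : R) * hs

lemma toXPM_eq_iff (p : ℕ) (x y : ExtendedUHP) :
    toXPM p x = toXPM p y ↔ ∃ β ∈ gammaPM p, β • y = x := by
  rw [toXPM, toXPM, Quotient.eq]
  change x ∈ MulAction.orbit (gammaPM p) y ↔ _
  simp only [MulAction.mem_orbit_iff, Subtype.exists]
  exact ⟨fun ⟨β, hβ, h⟩ => ⟨β, hβ, h⟩, fun ⟨β, hβ, h⟩ => ⟨β, hβ, h⟩⟩

lemma reduce_eq_iff {n : ℕ} (γ : SL(2, ℤ)) (g : Matrix.SpecialLinearGroup (Fin 2) (ZMod n)) :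
    reduce n γ = g ↔ ∀ i j, ((γ i j : ℤ) : ZMod n) = g i j :=
  Matrix.SpecialLinearGroup.ext_iff _ _

lemma exists_int_modEq {p : ℕ} (hp : Odd p) (m : ZMod 4) (n : ZMod p) :
    ∃ N : ℤ, (N : ZMod 4) = m ∧ (N : ZMod p) = n := by
  have hcop : Nat.Coprime 4 p := by
    rw [show 4 = 2 ^ 2 by norm_num]
    exact Nat.Coprime.pow_left 2 (Nat.coprime_two_left.2 hp)
  let e := ZMod.chineseRemainder hcop
  obtain ⟨N, hN⟩ := ZMod.intCast_surjective (e.symm (m, n))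
  have := congrArg e hN
  rw [map_intCast, RingEquiv.apply_symm_apply] at this
  exact ⟨N, congrArg Prod.fst this, congrArg Prod.snd this⟩

theorem toXPM_smul_infty_eq_iff {p : ℕ} (hp : Odd p) (γ γ' : SL(2, ℤ)) :
    toXPM p (Sum.inr (γ • (OnePoint.infty : OnePoint ℚ))) =
      toXPM p (Sum.inr (γ' • (OnePoint.infty : OnePoint ℚ))) ↔
    SignRel p (γ 0 0) (γ 1 0) (γ' 0 0) (γ' 1 0) := by
  rw [toXPM_eq_iff]
  constructor
  · rintro ⟨β, ⟨h4, hp'⟩, h⟩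
    have h : (β * γ') • (OnePoint.infty : OnePoint ℚ) = γ • (OnePoint.infty : OnePoint ℚ) := by
      rw [mul_smul]; exact Sum.inr_injective h
    obtain ⟨s, hs0, hs1⟩ := first_column_of_smul_infty_eq h.symm
    have hcast (R : Type) [CommRing R] (t : ℤˣ) (h00 : ((β 0 0 : ℤ) : R) = (t : ℤ))
        (h01 : ((β 0 1 : ℤ) : R) = 0) (h10 : ((β 1 0 : ℤ) : R) = 0)
        (h11 : ((β 1 1 : ℤ) : R) = (t : ℤ)) :
        ((γ' 0 0 : ℤ) : R) = ((t * s : ℤˣ) : ℤ) * (γ 0 0 : ℤ) ∧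
          ((γ' 1 0 : ℤ) : R) = ((t * s : ℤˣ) : ℤ) * (γ 1 0 : ℤ) := by
      have e0 := intCast_first_column_mul β γ' h00 h01 h10 h11 0
      have e1 := intCast_first_column_mul β γ' h00 h01 h10 h11 1
      have ht : ((t : ℤ) : R) * (t : ℤ) = 1 := by
        rw [← Int.cast_mul, ← Units.val_mul, Int.units_mul_self]; simp
      rw [hs0] at e0
      rw [hs1] at e1
      push_cast at e0 e1 ⊢
      exact ⟨by linear_combination -(t : ℤ) * e0 - (γ' 0 0 : ℤ) * ht,
        by linear_combination -(t : ℤ) * e1 - (γ' 1 0 : ℤ) * ht⟩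
    constructor
    · rw [CongruenceSubgroup.Gamma_mem] at h4
      have := hcast (ZMod 4) 1 (by simpa using h4.1) h4.2.1 h4.2.2.1 (by simpa using h4.2.2.2)
      exact ⟨Units.map (Int.castRingHom (ZMod 4)).toMonoidHom (1 * s), this⟩
    · rcases hp' with hp' | hp' <;> rw [reduce_eq_iff] at hp'
      · exact ⟨1 * s, hcast (ZMod p) 1 (by simp [hp']) (by simp [hp']) (by simp [hp'])
          (by simp [hp'])⟩
      · exact ⟨-1 * s, hcast (ZMod p) (-1) (by simp [hp']) (by simp [hp']) (by simp [hp'])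
          (by simp [hp'])⟩
  · rintro ⟨⟨ε, ha, hc⟩, ν, ha', hc'⟩
    obtain ⟨e, he⟩ : ∃ e : ℤˣ, (ε : ZMod 4) = (e : ℤ) := by
      rcases units_zmod_four ε with h | h
      · exact ⟨1, by simp [h]⟩
      · exact ⟨-1, by simp [h]⟩
    have hsq (R : Type) [CommRing R] (t : ℤˣ) : ((t : ℤ) : R) * (t : ℤ) = 1 := by
      rw [← Int.cast_mul, ← Units.val_mul, Int.units_mul_self]; simp
    rw [he] at ha hc
    obtain ⟨g00, g10, g11⟩ := intCast_inv_mul (hsq (ZMod 4) e) ha hc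
    obtain ⟨k00, k10, k11⟩ := intCast_inv_mul (hsq (ZMod p) ν) ha' hc'
    -- N makes the integral matrix δ, which fixes ∞, congruent to γ⁻¹γ' modulo 4 and to eν times it
    -- modulo p. Then γδγ'⁻¹ is 1 modulo 4 and ±1 modulo p, and carries γ'∞ to γ∞.
    obtain ⟨N, hN4, hNp⟩ := exists_int_modEq hp (((γ⁻¹ * γ') 0 1 : ℤ) : ZMod 4)
      (((e * ν : ℤˣ) : ℤ) * (((γ⁻¹ * γ') 0 1 : ℤ) : ZMod p))
    let δ : SL(2, ℤ) := mkSL (e : ℤ) N 0 (e : ℤ)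
      (by rw [mul_zero, sub_zero, ← Units.val_mul, Int.units_mul_self]; rfl)
    have hδ : δ • (OnePoint.infty : OnePoint ℚ) = OnePoint.infty :=
      (smul_infty_eq_infty_iff δ).2 rfl
    have hδ4 : reduce 4 δ = reduce 4 (γ⁻¹ * γ') := by
      rw [reduce_eq_iff]
      intro i j
      fin_cases i <;> fin_cases j
      · exact g00.symm
      · exact hN4
      · exact (Int.cast_zero).trans g10.symm
      · exact g11.symm
    have hδp (t : ℤˣ) (ht : t = e * ν) (i j : Fin 2) :
        ((δ i j : ℤ) : ZMod p) = (t : ℤ) * (((γ⁻¹ * γ') i j : ℤ) : ZMod p) := by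
      have hν := hsq (ZMod p) ν
      subst ht
      fin_cases i <;> fin_cases j
      · change ((e : ℤ) : ZMod p) = _ * (((γ⁻¹ * γ') 0 0 : ℤ) : ZMod p)
        rw [k00]; push_cast; linear_combination -((e : ℤ) : ZMod p) * hν
      · exact hNp
      · change ((0 : ℤ) : ZMod p) = _ * (((γ⁻¹ * γ') 1 0 : ℤ) : ZMod p)
        rw [k10]; simp
      · change ((e : ℤ) : ZMod p) = _ * (((γ⁻¹ * γ') 1 1 : ℤ) : ZMod p)
        rw [k11]; push_cast; linear_combination -((e : ℤ) : ZMod p) * hν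
    refine ⟨γ * δ * γ'⁻¹, ⟨?_, ?_⟩, ?_⟩
    · rw [CongruenceSubgroup.Gamma_mem']
      change reduce 4 _ = 1
      rw [map_mul, map_mul, hδ4]
      simp
    · rcases Int.units_eq_one_or (e * ν) with h | h
      · left
        have : reduce p δ = reduce p (γ⁻¹ * γ') := by
          rw [reduce_eq_iff]
          intro i j
          rw [hδp 1 h.symm, Units.val_one, Int.cast_one, one_mul]
          rfl
        rw [map_mul, map_mul, this]
        simp
      · right
        have : reduce p δ = -reduce p (γ⁻¹ * γ') := by
          rw [reduce_eq_iff]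
          intro i j
          rw [hδp (-1) h.symm, Units.val_neg, Units.val_one, Int.cast_neg, Int.cast_one,
            neg_one_mul]
          rfl
        rw [map_mul, map_mul, this]
        simp
    · change Sum.inr ((γ * δ * γ'⁻¹) • γ' • (OnePoint.infty : OnePoint ℚ)) = _
      rw [mul_smul, inv_smul_smul, mul_smul, hδ]

/-! ### Existence and uniqueness of the map -/

lemma IsTheMap.apply_smul_infty {p : ℕ} [Fact p.Prime] (hp : Odd p)
    {F : XPM p → ℙ ℂ (Coord p → ℂ)} (hF : IsTheMap p F) (γ : SL(2, ℤ)) :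
    F (toXPM p (Sum.inr (γ • (OnePoint.infty : OnePoint ℚ)))) =
      Projectivization.mk ℂ (cuspVec p (γ 0 0) (γ 1 0))
        (cuspVec_ne_zero (Fact.out : p.Prime).ne_zero _ _) := by
  obtain ⟨v, hv, hlim, h⟩ := hF.2 γ
  have : v = cuspVec p (γ 0 0) (γ 1 0) :=
    funext fun i => tendsto_nhds_unique (hlim i) (tendsto_coordForm_slash hp γ i)
  subst this
  exact h

lemma IsTheMap.unique {p : ℕ} [Fact p.Prime] (hp : Odd p) {F F' : XPM p → ℙ ℂ (Coord p → ℂ)}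
    (hF : IsTheMap p F) (hF' : IsTheMap p F') : F = F' := by
  funext x
  induction x using Quotient.inductionOn with
  | h x =>
    rcases x with z | x
    · obtain ⟨h, e⟩ := hF.1 z
      obtain ⟨h', e'⟩ := hF'.1 z
      exact e.trans e'.symm
    · obtain ⟨γ, rfl⟩ := exists_smul_infty_eq x
      exact (hF.apply_smul_infty hp γ).trans (hF'.apply_smul_infty hp γ).symm

lemma mk_coordForm_smul {p : ℕ} [Fact p.Prime] (hp : Odd p) {β : SL(2, ℤ)}
    (hβ : β ∈ gammaPM p) (z : ℍ) :
    Projectivization.mk ℂ (fun i => coordForm p i (β • z)) (exists_coordForm_ne_zero p _) =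
      Projectivization.mk ℂ (fun i => coordForm p i z) (exists_coordForm_ne_zero p _) := by
  rw [Projectivization.mk_eq_mk_iff']
  refine ⟨UpperHalfPlane.denom β z, funext fun i => ?_⟩
  have h := congrFun (coordForm_slash_of_mem_gammaPM hp hβ i) z
  rw [ModularForm.SL_slash_apply] at h
  rw [Pi.smul_apply, ← h, smul_eq_mul, mul_comm (coordForm p i (β • z)), ← mul_assoc, zpow_neg_one,
    mul_inv_cancel₀ (UpperHalfPlane.denom_ne_zero _ z), one_mul]

/-- At cusps, independence of the representative is deduced from the classification of constant term
vectors: equality on the curve gives agreement up to units. -/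
theorem exists_isTheMap {p : ℕ} [Fact p.Prime] (hp : Odd p) :
    ∃ F : XPM p → ℙ ℂ (Coord p → ℂ), IsTheMap p F := by
  have hp0 := (Fact.out : p.Prime).ne_zero
  choose rep hrep using exists_smul_infty_eq
  let f : ExtendedUHP → ℙ ℂ (Coord p → ℂ) := Sum.elim
    (fun z => Projectivization.mk ℂ (fun i => coordForm p i z) (exists_coordForm_ne_zero p z))
    (fun x => Projectivization.mk ℂ (cuspVec p (rep x 0 0) (rep x 1 0)) (cuspVec_ne_zero hp0 _ _))
  have hcusp (γ γ' : SL(2, ℤ)) (h : toXPM p (Sum.inr (γ • (OnePoint.infty : OnePoint ℚ))) =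
      toXPM p (Sum.inr (γ' • (OnePoint.infty : OnePoint ℚ)))) :
      Projectivization.mk ℂ (cuspVec p (γ 0 0) (γ 1 0)) (cuspVec_ne_zero hp0 _ _) =
        Projectivization.mk ℂ (cuspVec p (γ' 0 0) (γ' 1 0)) (cuspVec_ne_zero hp0 _ _) :=
    (mk_cuspVec_eq_iff hp (isCoprime_first_column γ) (isCoprime_first_column γ') _ _).2
      ((toXPM_smul_infty_eq_iff hp γ γ').1 h).unitRel
  have hf (x y : ExtendedUHP) (h : toXPM p x = toXPM p y) : f x = f y := by
    obtain ⟨β, hβ, e⟩ := (toXPM_eq_iff p x y).1 h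
    rcases x with z | x <;> rcases y with w | y
    · obtain rfl : β • w = z := Sum.inl_injective e
      exact mk_coordForm_smul hp hβ w
    · cases e
    · cases e
    · exact hcusp _ _ (by rw [hrep, hrep]; exact h)
  refine ⟨fun x => Quotient.liftOn x f fun x y hxy => hf x y (Quotient.sound hxy),
    fun z => ⟨exists_coordForm_ne_zero p z, rfl⟩, fun γ => ?_⟩
  refine ⟨_, cuspVec_ne_zero hp0 _ _, tendsto_coordForm_slash hp γ, ?_⟩
  exact hcusp _ _ (by rw [hrep])

lemma exists_cuspPt_eq {a c : ℤ} (h : IsCoprime a c) : ∃ γ : SL(2, ℤ), γ 0 0 = a ∧ γ 1 0 = c ∧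
    ∀ p, cuspPt p a c = toXPM p (Sum.inr (γ • (OnePoint.infty : OnePoint ℚ))) := by
  obtain ⟨γ, h0, h1⟩ := exists_first_column h
  exact ⟨γ, h0, h1, fun p => by rw [cuspPt, smul_infty_eq_ratCusp, h0, h1]⟩

lemma IsTheMap.apply_cuspPt_eq_iff {p : ℕ} [Fact p.Prime] (hp : Odd p)
    {F : XPM p → ℙ ℂ (Coord p → ℂ)} (hF : IsTheMap p F) {a c a' c' : ℤ} (h : IsCoprime a c)
    (h' : IsCoprime a' c') : F (cuspPt p a c) = F (cuspPt p a' c') ↔ UnitRel p a c a' c' := by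
  obtain ⟨γ, rfl, rfl, e⟩ := exists_cuspPt_eq h
  obtain ⟨γ', rfl, rfl, e'⟩ := exists_cuspPt_eq h'
  rw [e, e', hF.apply_smul_infty hp, hF.apply_smul_infty hp, mk_cuspVec_eq_iff hp h h']

lemma cuspPt_eq_iff {p : ℕ} (hp : Odd p) {a c a' c' : ℤ} (h : IsCoprime a c)
    (h' : IsCoprime a' c') : cuspPt p a c = cuspPt p a' c' ↔ SignRel p a c a' c' := by
  obtain ⟨γ, rfl, rfl, e⟩ := exists_cuspPt_eq h
  obtain ⟨γ', rfl, rfl, e'⟩ := exists_cuspPt_eq h'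
  rw [e, e', toXPM_smul_infty_eq_iff hp]

/-! ### Counting cusps and their images -/

lemma exists_isCoprime_add_mul {a N c : ℤ} (hc : c ≠ 0)
    (h : ∀ q : ℕ, q.Prime → (q : ℤ) ∣ a → (q : ℤ) ∣ N → ¬ (q : ℤ) ∣ c) :
    ∃ k : ℤ, IsCoprime (a + N * k) c := by
  classical
  let s : Finset ℕ := c.natAbs.primeFactors.filter fun q : ℕ => ¬ (q : ℤ) ∣ a
  -- A prime q of c divides this product exactly when q ∤ a. Thus q divides exactly one of a and Nk,
  -- the case q ∣ a using q ∤ N.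
  refine ⟨∏ q ∈ s, ((q : ℕ) : ℤ), ?_⟩
  rw [Int.isCoprime_iff_gcd_eq_one]
  refine Nat.coprime_of_dvd fun q hq hq1 hq2 => ?_
  have h1 := Int.natCast_dvd.2 hq1
  have h2 := Int.natCast_dvd.2 hq2
  have hqp := Nat.prime_iff_prime_int.1 hq
  by_cases ha : (q : ℤ) ∣ a
  · have hN : ¬ (q : ℤ) ∣ N := fun hN => h q hq ha hN h2
    rcases hqp.dvd_or_dvd ((dvd_add_right ha).1 h1) with h3 | h3
    · exact hN h3
    · obtain ⟨r, hr, hqr⟩ := (Prime.dvd_finsetProd_iff hqp _).1 h3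
      rw [Finset.mem_filter, Nat.mem_primeFactors] at hr
      rw [Int.natCast_dvd_natCast, Nat.prime_dvd_prime_iff_eq hq hr.1.1] at hqr
      exact hr.2 (hqr ▸ ha)
  · have hs : q ∈ s := by
      simp only [s, Finset.mem_filter, Nat.mem_primeFactors]
      exact ⟨⟨hq, hq2, by simpa using hc⟩, ha⟩
    have h3 : (q : ℤ) ∣ ∏ q ∈ s, (q : ℤ) := Finset.dvd_prod_of_mem (fun q : ℕ => (q : ℤ)) hs
    exact ha ((dvd_add_left (h3.mul_left N)).1 h1)

/-- Vectors modulo `4` which are not divisible by `2`. -/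
abbrev PrimFour : Type := {u : ZMod 4 × ZMod 4 // ¬ (2 * u.1 = 0 ∧ 2 * u.2 = 0)}

/-- Nonzero vectors modulo `p`. -/
abbrev NonzeroVec (p : ℕ) : Type := {v : ZMod p × ZMod p // ¬ (v.1 = 0 ∧ v.2 = 0)}

lemma exists_coprime_lift {p : ℕ} [Fact p.Prime] (hp : Odd p) (x : PrimFour × NonzeroVec p) :
    ∃ w : ℤ × ℤ, IsCoprime w.1 w.2 ∧ ((w.1 : ZMod 4) = x.1.1.1 ∧ (w.2 : ZMod 4) = x.1.1.2) ∧
      ((w.1 : ZMod p) = x.2.1.1 ∧ (w.2 : ZMod p) = x.2.1.2) := by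
  obtain ⟨⟨⟨u1, u2⟩, hu⟩, ⟨⟨v1, v2⟩, hv⟩⟩ := x
  have hp0 : (p : ℤ) ≠ 0 := by exact_mod_cast (Fact.out : p.Prime).ne_zero
  obtain ⟨a, ha4, hap⟩ := exists_int_modEq hp u1 v1
  obtain ⟨c, hc0, hc4, hcp⟩ : ∃ c : ℤ, c ≠ 0 ∧ (c : ZMod 4) = u2 ∧ (c : ZMod p) = v2 := by
    obtain ⟨c, h4, h⟩ := exists_int_modEq hp u2 v2
    have h44 : (4 : ZMod 4) = 0 := by decide
    by_cases hc : c = 0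
    · subst hc
      -- The coprimality lemma needs c ≠ 0; 4p has the same residues as 0.
      exact ⟨4 * p, by simpa using hp0, by rw [← h4]; push_cast; rw [h44]; simp,
        by rw [← h]; simp⟩
    · exact ⟨c, hc, h4, h⟩
  obtain ⟨k, hk⟩ := exists_isCoprime_add_mul (a := a) (N := 4 * p) hc0 (by
    intro q hq hqa hqN hqc
    rcases (Nat.prime_iff_prime_int.1 hq).dvd_or_dvd hqN with h | h
    · have h4 : q ∣ 2 ^ 2 := by exact_mod_cast h
      obtain rfl : q = 2 := (Nat.prime_dvd_prime_iff_eq hq Nat.prime_two).1 (hq.dvd_of_dvd_pow h4)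
      obtain ⟨a', rfl⟩ := hqa
      obtain ⟨c', rfl⟩ := hqc
      have h44 : (4 : ZMod 4) = 0 := by decide
      refine hu ⟨?_, ?_⟩
      · rw [← ha4]; push_cast; linear_combination (a' : ZMod 4) * h44
      · rw [← hc4]; push_cast; linear_combination (c' : ZMod 4) * h44
    · rw [Int.natCast_dvd_natCast, Nat.prime_dvd_prime_iff_eq hq Fact.out] at h
      subst h
      exact hv ⟨by rw [← hap]; exact (ZMod.intCast_zmod_eq_zero_iff_dvd _ _).2 hqa,
        by rw [← hcp]; exact (ZMod.intCast_zmod_eq_zero_iff_dvd _ _).2 hqc⟩)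
  refine ⟨(a + 4 * p * k, c), hk, ⟨?_, hc4⟩, ?_, hcp⟩
  · have h44 : (4 : ZMod 4) = 0 := by decide
    push_cast
    rw [h44, ha4]; ring
  · push_cast
    rw [ZMod.natCast_self, hap]; ring

/-- If a group-like index set acts freely and its orbits are the fibres of `f`, then the number of
values of `f` is the quotient of the cardinalities. -/
lemma card_eq_card_mul_ncard_range {X Y G : Type*} (f : X → Y) (act : G → X → X)
    (hact : ∀ x, Function.Injective fun g => act g x)
    (hf : ∀ x y, f x = f y ↔ ∃ g, act g x = y) :
    Nat.card X = Nat.card G * (Set.range f).ncard := by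
  rw [← Nat.card_coe_set_eq, ← Nat.card_prod]
  choose s hs using fun y : Set.range f => y.2
  have hact' (g : G) (x : X) : f (act g x) = f x := ((hf _ _).2 ⟨g, rfl⟩).symm
  refine (Nat.card_congr (Equiv.ofBijective (fun q : G × Set.range f => act q.1 (s q.2))
    ⟨?_, ?_⟩)).symm
  · rintro ⟨g, y⟩ ⟨g', y'⟩ h
    have h1 := congrArg f h
    simp only [hact', hs] at h1
    obtain rfl := Subtype.ext h1
    exact Prod.ext (hact _ h) rfl
  · intro x
    obtain ⟨g, hg⟩ := (hf (s ⟨f x, x, rfl⟩) x).1 (hs _)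
    exact ⟨(g, ⟨f x, x, rfl⟩), hg⟩

/-- Scaling of a vector modulo `4` by a unit. -/
def PrimFour.scale (ε : (ZMod 4)ˣ) (u : PrimFour) : PrimFour :=
  ⟨(ε * u.1.1, ε * u.1.2), by
    rw [mul_left_comm, mul_left_comm 2, Units.mul_right_eq_zero, Units.mul_right_eq_zero]
    exact u.2⟩

/-- Scaling of a vector modulo `p` by a unit. -/
def NonzeroVec.scale {p : ℕ} (μ : (ZMod p)ˣ) (v : NonzeroVec p) : NonzeroVec p :=
  ⟨(μ * v.1.1, μ * v.1.2), by
    rw [Units.mul_right_eq_zero, Units.mul_right_eq_zero]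
    exact v.2⟩

lemma PrimFour.scale_injective (u : PrimFour) : Function.Injective fun ε => scale ε u := by
  intro ε ε' h
  have key : ∀ (ε ε' : (ZMod 4)ˣ) (a c : ZMod 4), ¬ (2 * a = 0 ∧ 2 * c = 0) →
      (ε : ZMod 4) * a = ε' * a → (ε : ZMod 4) * c = ε' * c → ε = ε' := by decide
  have h' := congrArg Subtype.val h
  exact key ε ε' _ _ u.2 (congrArg Prod.fst h') (congrArg Prod.snd h')

lemma NonzeroVec.scale_injective {p : ℕ} [Fact p.Prime] (v : NonzeroVec p) :
    Function.Injective fun μ => scale μ v := by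
  intro μ μ' h
  have h' := congrArg Subtype.val h
  have h1 : (μ : ZMod p) * v.1.1 = μ' * v.1.1 := congrArg Prod.fst h'
  have h2 : (μ : ZMod p) * v.1.2 = μ' * v.1.2 := congrArg Prod.snd h'
  by_cases h0 : v.1.1 = 0
  · exact Units.ext (mul_right_cancel₀ (fun h3 => v.2 ⟨h0, h3⟩) h2)
  · exact Units.ext (mul_right_cancel₀ h0 h1)

lemma card_primFour : Nat.card PrimFour = 12 := by
  rw [Nat.card_eq_fintype_card]; decide

lemma card_nonzeroVec (p : ℕ) [Fact p.Prime] : Nat.card (NonzeroVec p) = p ^ 2 - 1 := by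
  have h : NonzeroVec p = {v : ZMod p × ZMod p // v ≠ 0} := by
    unfold NonzeroVec
    congr 1
    funext v
    rw [ne_eq, Prod.ext_iff]
    rfl
  rw [h, Nat.card_eq_fintype_card, Fintype.card_subtype_compl, Fintype.card_prod, ZMod.card,
    Fintype.card_subtype_eq, pow_two]

lemma card_units_zmod_four : Nat.card (ZMod 4)ˣ = 2 := by
  rw [Nat.card_eq_fintype_card]; decide

/-- A coprime integral vector with given residues modulo `4` and `p`. -/
noncomputable def coprimeLift {p : ℕ} [Fact p.Prime] (hp : Odd p) (x : PrimFour × NonzeroVec p) :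
    ℤ × ℤ :=
  (exists_coprime_lift hp x).choose

lemma coprimeLift_spec {p : ℕ} [Fact p.Prime] (hp : Odd p) (x : PrimFour × NonzeroVec p) :
    IsCoprime (coprimeLift hp x).1 (coprimeLift hp x).2 ∧
      (((coprimeLift hp x).1 : ZMod 4) = x.1.1.1 ∧ ((coprimeLift hp x).2 : ZMod 4) = x.1.1.2) ∧
      (((coprimeLift hp x).1 : ZMod p) = x.2.1.1 ∧ ((coprimeLift hp x).2 : ZMod p) = x.2.1.2) :=
  (exists_coprime_lift hp x).choose_spec

/-- The cusp of `X_±(4p)` with given residues modulo `4` and `p`. -/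
noncomputable def residueCusp {p : ℕ} [Fact p.Prime] (hp : Odd p) (x : PrimFour × NonzeroVec p) :
    XPM p :=
  cuspPt p (coprimeLift hp x).1 (coprimeLift hp x).2

lemma range_residueCusp {p : ℕ} [Fact p.Prime] (hp : Odd p) :
    Set.range (residueCusp hp) = cuspSet p := by
  apply Set.Subset.antisymm
  · rintro _ ⟨x, rfl⟩
    exact ⟨_, rfl⟩
  · rintro _ ⟨x, rfl⟩
    obtain ⟨γ, rfl⟩ := exists_smul_infty_eq x
    have hco := isCoprime_first_column γ
    let x : PrimFour × NonzeroVec p :=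
      (⟨((γ 0 0 : ℤ), (γ 1 0 : ℤ)), not_even_of_isCoprime hco⟩,
        ⟨((γ 0 0 : ℤ), (γ 1 0 : ℤ)), intCast_not_both_zero (Fact.out : p.Prime).ne_one hco⟩)
    refine ⟨x, ?_⟩
    have hs := coprimeLift_spec hp x
    change residueCusp hp x = toXPM p (Sum.inr (γ • (OnePoint.infty : OnePoint ℚ)))
    rw [smul_infty_eq_ratCusp, ← cuspPt, residueCusp, cuspPt_eq_iff hp hs.1 hco]
    exact ⟨⟨1, by rw [hs.2.1.1, hs.2.1.2]; simp [x]⟩, 1, by rw [hs.2.2.1, hs.2.2.2]; simp [x]⟩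

lemma signRel_coprimeLift_iff {p : ℕ} [Fact p.Prime] (hp : Odd p)
    (x y : PrimFour × NonzeroVec p) :
    SignRel p (coprimeLift hp x).1 (coprimeLift hp x).2 (coprimeLift hp y).1
      (coprimeLift hp y).2 ↔ ∃ g : (ZMod 4)ˣ × ℤˣ, (PrimFour.scale g.1 x.1,
        NonzeroVec.scale (Units.map (Int.castRingHom (ZMod p)).toMonoidHom g.2) x.2) = y := by
  have hx := coprimeLift_spec hp x
  have hy := coprimeLift_spec hp y
  simp only [SignRel, hx.2.1.1, hx.2.1.2, hx.2.2.1, hx.2.2.2, hy.2.1.1, hy.2.1.2, hy.2.2.1,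
    hy.2.2.2]
  constructor
  · rintro ⟨⟨ε, h1, h2⟩, ν, h3, h4⟩
    exact ⟨(ε, ν), Prod.ext (Subtype.ext (Prod.ext h1.symm h2.symm))
      (Subtype.ext (Prod.ext h3.symm h4.symm))⟩
  · rintro ⟨⟨ε, ν⟩, rfl⟩
    exact ⟨⟨ε, rfl, rfl⟩, ν, rfl, rfl⟩

lemma unitRel_coprimeLift_iff {p : ℕ} [Fact p.Prime] (hp : Odd p)
    (x y : PrimFour × NonzeroVec p) :
    UnitRel p (coprimeLift hp x).1 (coprimeLift hp x).2 (coprimeLift hp y).1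
      (coprimeLift hp y).2 ↔ ∃ g : (ZMod 4)ˣ × (ZMod p)ˣ,
        (PrimFour.scale g.1 x.1, NonzeroVec.scale g.2 x.2) = y := by
  have hx := coprimeLift_spec hp x
  have hy := coprimeLift_spec hp y
  simp only [UnitRel, hx.2.1.1, hx.2.1.2, hx.2.2.1, hx.2.2.2, hy.2.1.1, hy.2.1.2, hy.2.2.1,
    hy.2.2.2]
  constructor
  · rintro ⟨⟨ε, h1, h2⟩, μ, h3, h4⟩
    exact ⟨(ε, μ), Prod.ext (Subtype.ext (Prod.ext h1.symm h2.symm))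
      (Subtype.ext (Prod.ext h3.symm h4.symm))⟩
  · rintro ⟨⟨ε, μ⟩, rfl⟩
    exact ⟨⟨ε, rfl, rfl⟩, μ, rfl, rfl⟩

/-- The signs stay distinct modulo an odd prime, which makes the sign action on nonzero vectors
free. -/
lemma unitsMap_int_injective {p : ℕ} [Fact p.Prime] (hp : p ≠ 2) :
    Function.Injective (Units.map (Int.castRingHom (ZMod p)).toMonoidHom) := by
  have : Fact (2 < p) := ⟨lt_of_le_of_ne (Fact.out : p.Prime).two_le hp.symm⟩
  have hne : (-1 : ZMod p) ≠ 1 := ZMod.neg_one_ne_one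
  intro a b h
  have h' := congrArg Units.val h
  rcases Int.units_eq_one_or a with rfl | rfl <;> rcases Int.units_eq_one_or b with rfl | rfl
  · rfl
  · exact absurd (by simpa using h'.symm) hne
  · exact absurd (by simpa using h') hne
  · rfl

theorem ncard_cuspSet {p : ℕ} [Fact p.Prime] (hp : Odd p) (hp2 : p ≠ 2) :
    (cuspSet p).ncard = 3 * (p ^ 2 - 1) := by
  have h := card_eq_card_mul_ncard_range (residueCusp hp)
    (fun (g : (ZMod 4)ˣ × ℤˣ) x => (PrimFour.scale g.1 x.1,
      NonzeroVec.scale (Units.map (Int.castRingHom (ZMod p)).toMonoidHom g.2) x.2))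
    (fun x g g' hg => Prod.ext (PrimFour.scale_injective _ (congrArg Prod.fst hg))
      (unitsMap_int_injective hp2 (NonzeroVec.scale_injective _ (congrArg Prod.snd hg))))
    (fun x y => by
      rw [residueCusp, residueCusp,
        cuspPt_eq_iff hp (coprimeLift_spec hp x).1 (coprimeLift_spec hp y).1,
        signRel_coprimeLift_iff])
  rw [range_residueCusp, Nat.card_prod, Nat.card_prod, card_primFour, card_nonzeroVec,
    card_units_zmod_four, show Nat.card ℤˣ = 2 by rw [Nat.card_eq_fintype_card]; rfl] at h
  lia

theorem IsTheMap.ncard_image_cuspSet {p : ℕ} [Fact p.Prime] (hp : Odd p)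
    {F : XPM p → ℙ ℂ (Coord p → ℂ)} (hF : IsTheMap p F) :
    (F '' cuspSet p).ncard = 6 * (p + 1) := by
  have h := card_eq_card_mul_ncard_range (F ∘ residueCusp hp)
    (fun (g : (ZMod 4)ˣ × (ZMod p)ˣ) x => (PrimFour.scale g.1 x.1, NonzeroVec.scale g.2 x.2))
    (fun x g g' hg => Prod.ext (PrimFour.scale_injective _ (congrArg Prod.fst hg))
      (NonzeroVec.scale_injective _ (congrArg Prod.snd hg)))
    (fun x y => by
      rw [Function.comp_apply, Function.comp_apply, residueCusp, residueCusp,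
        hF.apply_cuspPt_eq_iff hp (coprimeLift_spec hp x).1 (coprimeLift_spec hp y).1,
        unitRel_coprimeLift_iff])
  rw [Set.range_comp, range_residueCusp, Nat.card_prod, Nat.card_prod, card_primFour,
    card_nonzeroVec, card_units_zmod_four,
    show Nat.card (ZMod p)ˣ = p - 1 by rw [Nat.card_eq_fintype_card, ZMod.card_units]] at h
  have hp1 := (Fact.out : p.Prime).one_lt
  -- Writing p = m + 1 removes truncated subtraction; the common factor 2m is the order of the
  -- acting group.
  obtain ⟨m, rfl⟩ : ∃ m, p = m + 1 := ⟨p - 1, by lia⟩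
  have hm : 0 < m := by lia
  have hsq : (m + 1) ^ 2 - 1 = m * (m + 2) := by
    rw [Nat.sub_eq_iff_eq_add (Nat.one_le_pow _ _ (by lia))]; ring
  rw [hsq, Nat.add_sub_cancel] at h
  refine Nat.eq_of_mul_eq_mul_left (show 0 < 2 * m by lia) ?_
  rw [← h]
  ring

end CuspIdent

theorem theorem3p5 (p : ℕ) [Fact p.Prime] (hp : p ≠ 2) :
    (∃! F : CuspIdent.XPM p → ℙ ℂ (CuspIdent.Coord p → ℂ), CuspIdent.IsTheMap p F) ∧
    ∀ F : CuspIdent.XPM p → ℙ ℂ (CuspIdent.Coord p → ℂ), CuspIdent.IsTheMap p F →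
      (∀ a c a' c' : ℤ, IsCoprime a c → IsCoprime a' c' →
        (F (CuspIdent.cuspPt p a c) = F (CuspIdent.cuspPt p a' c') ↔
          ∃ μ : (ZMod (4 * p))ˣ,
            (a' : ZMod (4 * p)) = μ * (a : ZMod (4 * p)) ∧
            (c' : ZMod (4 * p)) = μ * (c : ZMod (4 * p)))) ∧
      (CuspIdent.cuspSet p).ncard = 3 * (p ^ 2 - 1) ∧
      (F '' CuspIdent.cuspSet p).ncard = 6 * (p + 1) := by
  have hodd : Odd p := (Fact.out : p.Prime).odd_of_ne_two hp
  refine ⟨?_, fun F hF => ⟨fun a c a' c' h h' => ?_, CuspIdent.ncard_cuspSet hodd hp,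
    hF.ncard_image_cuspSet hodd⟩⟩
  · obtain ⟨F, hF⟩ := CuspIdent.exists_isTheMap (p := p) hodd
    exact ⟨F, hF, fun F' hF' => hF'.unique hodd hF⟩
  · rw [hF.apply_cuspPt_eq_iff hodd h h', CuspIdent.unitRel_iff_exists_unit hodd]
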